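/- Let $d\ge 1$, let $\mu$ be a compactly supported finite (positive) Borel measure on $\mathbb R^d\times\mathbb R^d$, and for $t>0$ let $$L_t(f,g)(x)=\int f(x-ty)\,g(x-tz)\,d\mu(y,z),\qquad L_{\mathrm{lac}}(f,g)(x)=\sup_{j\in\mathbb Z}|L_{2^j}(f,g)(x)|.$$ Let $\mathfrak B\subset\mathbb R^3$ be the set of all triples $(1/p,1/q,1/r)$ with $1\le p,q\le\infty$, $0<r\le\infty$, such that $L_1$ (equivalently, by scaling, every $L_t$, $t>0$) is bounded from $L^p(\mathbb R^d)\times L^q(\mathbb R^d)$ to $L^r(\mathbb R^d)$. Suppose that $\mathfrak B$ contains some triple with $1/p+1/q>1/r$, and that for every $(1/p,1/q,1/r)$ in the interior of $\mathfrak B$ (in $\mathbb R^3$) there are $\eta_1,\eta_2>0$ and a constant $C$, depending only on $\mu,p,q,r$, such that $$\|L_t((I-\tau_{y_1})f,(I-\tau_{y_2})g)\|_{L^r}\le C\,t^{d(\frac1r-\frac1p-\frac1q)}\Big(\frac{|y_1|}{t}\Big)^{\eta_1}\Big(\frac{|y_2|}{t}\Big)^{\eta_2}\|f\|_{L^p}\|g\|_{L^q}$$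 for all $t>0$, $y_1,y_2\in\mathbb R^d$, $f\in L^p$, $g\in L^q$, where $\tau_yf(x)=f(x-y)$. For $\gamma\in(0,1)$ call a family $\mathcal S$ of axis-parallel cubes in $\mathbb R^d$ $\gamma$-sparse if each $Q\in\mathcal S$ has a measurable subset $F_Q$ with $|F_Q|\ge\gamma|Q|$ such that $F_Q\cap F_{Q'}=\emptyset$ for distinct $Q,Q'\in\mathcal S$. Write $\langle\varphi\rangle_{Q,s}=\big(|Q|^{-1}\int_Q|\varphi|^s\big)^{1/s}$. Then for every $(1/p,1/q,1/r)$ in the interior of $\mathfrak B$ with $r\ge p$, $r\ge q$ and $r>1$, and every $\gamma\in(0,1)$, there is a finite constant $C$, depending only on $\mu,d,p,q,r,\gamma$, such that for all locally integrable $f,g,h:\mathbb R^d\to\mathbb C$ $$\int_{\mathbb R^d}L_{\mathrm{lac}}(f,g)\,|h|\,dx\le C\,\sup_{\mathcal S\ \gamma\text{-sparse}}\ \sum_{Q\in\mathcal S}|Q|\,\langle f\rangle_{Q,p}\,\langle g\rangle_{Q,q}\,\langle h\rangle_{Q,r'},\qquad \frac1r+\frac1{r'}=1,$$ where both sides take values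 in $[0,\infty]$. -/

import Mathlib

open MeasureTheory Set
open scoped ENNReal NNReal

noncomputable section

/-- The bilinear convolution at scale `t` with the measure `μ` on `ℝᵈ × ℝᵈ`:
`L_t(f, g)(x) = ∫ f(x - t y) g(x - t z) dμ(y, z)`. -/
def bilinConv {d : ℕ}
    (μ : Measure (EuclideanSpace ℝ (Fin d) × EuclideanSpace ℝ (Fin d))) (t : ℝ)
    (f g : EuclideanSpace ℝ (Fin d) → ℂ) (x : EuclideanSpace ℝ (Fin d)) : ℂ :=
  ∫ w, f (x - t • w.1) * g (x - t • w.2) ∂μ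

/-- The lacunary maximal operator `L_lac(f, g)(x) = sup_{j ∈ ℤ} |L_{2^j}(f, g)(x)|`,
with values in `[0, ∞]`. -/
def lacunaryMax {d : ℕ}
    (μ : Measure (EuclideanSpace ℝ (Fin d) × EuclideanSpace ℝ (Fin d)))
    (f g : EuclideanSpace ℝ (Fin d) → ℂ) (x : EuclideanSpace ℝ (Fin d)) : ℝ≥0∞ :=
  ⨆ j : ℤ, ‖bilinConv μ ((2 : ℝ) ^ j) f g x‖ₑ

/-- The operator `(I - τ_y) f`, where `τ_y f(x) = f(x - y)`. -/
def subTranslate {d : ℕ} (y : EuclideanSpace ℝ (Fin d))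
    (f : EuclideanSpace ℝ (Fin d) → ℂ) (x : EuclideanSpace ℝ (Fin d)) : ℂ :=
  f x - f (x - y)

/-- `L_t : L^p × L^q → L^r` is bounded: the defining integral converges absolutely at almost every
point, and the norm inequality holds. -/
def BilinBounded {d : ℕ}
    (μ : Measure (EuclideanSpace ℝ (Fin d) × EuclideanSpace ℝ (Fin d))) (t : ℝ)
    (p q r : ℝ≥0∞) : Prop :=
  ∃ C : ℝ≥0, ∀ f g : EuclideanSpace ℝ (Fin d) → ℂ,
    MemLp f p volume → MemLp g q volume →
      (∀ᵐ x, Integrable (fun w => f (x - t • w.1) * g (x - t • w.2)) μ) ∧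
      eLpNorm (bilinConv μ t f g) r volume ≤ C * eLpNorm f p volume * eLpNorm g q volume

/-- The Lebesgue exponent `1 / a` in `(0, ∞]` with reciprocal `a ≥ 0`. -/
def expOfInv (a : ℝ) : ℝ≥0∞ := (ENNReal.ofReal a)⁻¹

/-- The boundedness set: all `(1/p, 1/q, 1/r)` with `1 ≤ p, q ≤ ∞` and `0 < r ≤ ∞` such that
`L_1 : L^p × L^q → L^r` is bounded (by scaling, this is the same for every `L_t`, `t > 0`). -/
def boundednessSet {d : ℕ}
    (μ : Measure (EuclideanSpace ℝ (Fin d) × EuclideanSpace ℝ (Fin d))) : Set (ℝ × ℝ × ℝ) :=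
  {v | v.1 ∈ Icc (0 : ℝ) 1 ∧ v.2.1 ∈ Icc (0 : ℝ) 1 ∧ 0 ≤ v.2.2 ∧
    BilinBounded μ 1 (expOfInv v.1) (expOfInv v.2.1) (expOfInv v.2.2)}

/-- The scaled continuity estimate at the finite exponents `p, q, r`, with exponents `η₁, η₂ > 0`
and a constant that are uniform in `t`, `y₁`, `y₂`, `f`, `g`. -/
def ContinuityEstimate {d : ℕ}
    (μ : Measure (EuclideanSpace ℝ (Fin d) × EuclideanSpace ℝ (Fin d))) (p q r : ℝ) : Prop :=
  ∃ η₁ η₂ : ℝ, 0 < η₁ ∧ 0 < η₂ ∧ ∃ C : ℝ, 0 ≤ C ∧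
    ∀ t : ℝ, 0 < t → ∀ y₁ y₂ : EuclideanSpace ℝ (Fin d),
    ∀ f g : EuclideanSpace ℝ (Fin d) → ℂ,
      MemLp f (ENNReal.ofReal p) volume → MemLp g (ENNReal.ofReal q) volume →
      eLpNorm (bilinConv μ t (subTranslate y₁ f) (subTranslate y₂ g)) (ENNReal.ofReal r) volume ≤
        ENNReal.ofReal (C * t ^ ((d : ℝ) * (1 / r - 1 / p - 1 / q)) *
          (‖y₁‖ / t) ^ η₁ * (‖y₂‖ / t) ^ η₂) *
        eLpNorm f (ENNReal.ofReal p) volume * eLpNorm g (ENNReal.ofReal q) volume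

/-- Axis-parallel cubes in `ℝᵈ`, given by the lower corner and the (positive) side length. -/
structure Cube (d : ℕ) where
  corner : Fin d → ℝ
  side : ℝ
  side_pos : 0 < side

/-- The point set of a cube (half-open). -/
def Cube.toSet {d : ℕ} (Q : Cube d) : Set (EuclideanSpace ℝ (Fin d)) :=
  {x | ∀ i, x i ∈ Ico (Q.corner i) (Q.corner i + Q.side)}

/-- A family `S` of cubes is `γ`-sparse if every `Q ∈ S` has a measurable part `F Q ⊆ Q` with
`|F Q| ≥ γ |Q|`, and these parts are pairwise disjoint. -/
def IsSparse {d : ℕ} (γ : ℝ) (S : Set (Cube d)) : Prop :=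
  ∃ F : Cube d → Set (EuclideanSpace ℝ (Fin d)),
    (∀ Q ∈ S, MeasurableSet (F Q) ∧ F Q ⊆ Q.toSet ∧
      ENNReal.ofReal γ * volume Q.toSet ≤ volume (F Q)) ∧
    ∀ Q ∈ S, ∀ Q' ∈ S, Q ≠ Q' → Disjoint (F Q) (F Q')

/-- The average `⟨φ⟩_{Q,s} = (|Q|⁻¹ ∫_Q |φ|^s)^{1/s}`. -/
def cubeAvg {d : ℕ} (φ : EuclideanSpace ℝ (Fin d) → ℂ) (Q : Cube d) (s : ℝ) : ℝ≥0∞ :=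
  ((volume Q.toSet)⁻¹ * ∫⁻ x in Q.toSet, ‖φ x‖ₑ ^ s) ^ (1 / s)

/-- The sparse form
`Λ_{S,p,q,s}(f, g, h) = ∑_{Q ∈ S} |Q| ⟨f⟩_{Q,p} ⟨g⟩_{Q,q} ⟨h⟩_{Q,s}`, valued in `[0, ∞]`. -/
def sparseForm {d : ℕ} (S : Set (Cube d)) (p q s : ℝ)
    (f g h : EuclideanSpace ℝ (Fin d) → ℂ) : ℝ≥0∞ :=
  ∑' Q : S, volume (Q : Cube d).toSet * cubeAvg f Q p * cubeAvg g Q q * cubeAvg h Q s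

end

/-! The proof is a stopping-time argument on dyadic grids in which the continuity estimate supplies
all the cancellation.

Choose `n₀` so that both components of `μ`-almost every `w` have norm at most `2 ^ n₀ / 3`. If `x`
lies in the middle third of its cell of side `2 ^ k`, then `L_{2^(k - n₀)}(f, g)(x)` only sees `f`
and `g` on that cell. Every `x` is in such a position, at each level up to a fixed top level, for
one of `3 ^ d` translated grids (`exists_mem_midCell`), so it suffices to dominate the localized
maximal function `gridMax` of one grid.

Inside a top cell `Q`, stop at the maximal cells where the average of `|f|^p` or `|g|^q` exceeds `B
= 2 / (1 - γ)` times its average over `Q`. They cover at most `(1 - γ)|Q|`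
(`mul_volume_stopIndex_le`), so the rest of `Q` serves as the sparse part `F_Q`. Levels inside a
stopping cell are left to the recursion (`lintegral_gridMax_le_add`), which terminates because only
levels above `b` are kept. The levels above the stopping cells must be bounded by one term of the
sparse form (`lintegral_iSup_activeSet_le`).

For that, split `f` at level `k` into a bounded good part (offset `0`) and mean-zero bad parts
living on stopping cells of level `k - n`, and split `g` likewise. A function with mean zero on
cells of side `2 ^ l` is an average of differences `(I - τ_y) u_y` with `|y| ≲ 2 ^ l`
(`hasShiftRep_of_integral_eq_zero`). The continuity estimate thus yields decay `θ₁ ^ n θ₂ ^ n'`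
(`exists_localBound`). For fixed `(n, n') ≠ (0, 0)` the supremum over levels is replaced by an `ℓ^r`
sum. It converges because the bad parts with fixed offset have disjoint supports as `k` varies, and
`p ≤ r` or `q ≤ r` lets one pass from `r`-th powers of norms to a quantity linear in `∫ |f_n|^p` or
`∫ |g_n'|^q` (`sum_levels_le`). For `(0, 0)` no summation is possible or needed: both factors are
bounded and `μ` is finite. Hölder against `h` and two geometric series finish the local estimate.

General `f` and `g` are reached by monotone convergence from the truncations `min (|f|, N)` and `min
(|g|, N)` and finitely many scales, the constant being independent of both. -/

/-- The Euclidean space `ℝᵈ`. -/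
abbrev Euc (d : ℕ) := EuclideanSpace ℝ (Fin d)

/-! ### Translated dyadic grids -/

/-- The index of the cell of level `k` containing `x`, in the dyadic grid with origin `s`. -/
noncomputable def gridIdx {d : ℕ} (s : Fin d → ℝ) (k : ℤ) (x : Euc d) : Fin d → ℤ :=
  fun i => ⌊(x i - s i) / (2 : ℝ) ^ k⌋

/-- The cell of level `k` and index `m` in the dyadic grid with origin `s`. -/
def gridCell {d : ℕ} (s : Fin d → ℝ) (k : ℤ) (m : Fin d → ℤ) : Set (Euc d) :=
  {x | gridIdx s k x = m}

/-- A dyadic cell as a cube. -/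
noncomputable def gridCube {d : ℕ} (s : Fin d → ℝ) (k : ℤ) (m : Fin d → ℤ) : Cube d where
  corner := fun i => s i + (2 : ℝ) ^ k * m i
  side := (2 : ℝ) ^ k
  side_pos := by positivity

/-- The volume of the cells of level `k`. -/
noncomputable def cellVol (d : ℕ) (k : ℤ) : ℝ≥0∞ := ENNReal.ofReal ((2 : ℝ) ^ k) ^ d

section Grid

variable {d : ℕ} (s : Fin d → ℝ)

lemma gridCube_toSet (k : ℤ) (m : Fin d → ℤ) : (gridCube s k m).toSet = gridCell s k m := by
  ext x
  have h2 : (0 : ℝ) < (2 : ℝ) ^ k := by positivity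
  simp only [Cube.toSet, gridCube, gridCell, gridIdx, mem_ofPred_eq, funext_iff, Int.floor_eq_iff,
    mem_Ico, le_div_iff₀ h2, div_lt_iff₀ h2]
  refine forall_congr' fun i => and_congr ?_ ?_
  · constructor <;> intro h <;> linarith
  · constructor <;> intro h <;> linarith

lemma measurable_gridIdx (k : ℤ) : Measurable (gridIdx s k) := by
  refine measurable_pi_iff.2 fun i => Int.measurable_floor.comp ?_
  fun_prop

lemma measurableSet_gridCell (k : ℤ) (m : Fin d → ℤ) : MeasurableSet (gridCell s k m) :=
  measurable_gridIdx s k (measurableSet_singleton m)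

lemma volume_box (a : Fin d → ℝ) (l : ℝ) :
    volume {x : Euc d | ∀ i, x i ∈ Ico (a i) (a i + l)} = ENNReal.ofReal l ^ d := by
  have h : {x : Euc d | ∀ i, x i ∈ Ico (a i) (a i + l)} =
      (WithLp.ofLp : Euc d → (Fin d → ℝ)) ⁻¹' (univ.pi fun i => Ico (a i) (a i + l)) := by
    ext x; simp
  rw [h, (PiLp.volume_preserving_ofLp (Fin d)).measure_preimage
    (MeasurableSet.univ_pi fun i => measurableSet_Ico).nullMeasurableSet, Real.volume_pi_Ico]
  simp

lemma volume_gridCell (k : ℤ) (m : Fin d → ℤ) : volume (gridCell s k m) = cellVol d k := by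
  rw [← gridCube_toSet, Cube.toSet, volume_box]
  rfl

lemma cellVol_ne_zero (k : ℤ) : cellVol d k ≠ 0 :=
  pow_ne_zero _ (by simp; positivity)

lemma cellVol_ne_top (k : ℤ) : cellVol d k ≠ ∞ := ENNReal.pow_ne_top ENNReal.ofReal_ne_top

lemma cellVol_succ (k : ℤ) : cellVol d (k + 1) = 2 ^ d * cellVol d k := by
  rw [cellVol, cellVol, ← mul_pow, zpow_add_one₀ two_ne_zero, mul_comm,
    ENNReal.ofReal_mul zero_le_two]
  simp

/-- Nestedness of the grid, for any origin: the index at a coarser level is the integer quotient by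
`2 ^ n` of the finer index. -/
lemma gridIdx_eq_of_le {k l : ℤ} (h : k ≤ l) {x y : Euc d} (hxy : gridIdx s k x = gridIdx s k y) :
    gridIdx s l x = gridIdx s l y := by
  obtain ⟨n, rfl⟩ := Int.le.dest h
  have key : ∀ z : Euc d, gridIdx s (k + n) z = fun i => gridIdx s k z i / ((2 ^ n : ℕ) : ℤ) := by
    intro z
    funext i
    simp only [gridIdx]
    rw [← Int.floor_div_natCast, zpow_add₀ two_ne_zero, zpow_natCast]
    congr 1
    push_cast
    rw [div_div]
  rw [key, key, hxy]

lemma abs_sub_lt_of_gridIdx_eq {k : ℤ} {x y : Euc d} (hxy : gridIdx s k x = gridIdx s k y)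
    (i : Fin d) : |x i - y i| < (2 : ℝ) ^ k := by
  have h2 : (0 : ℝ) < (2 : ℝ) ^ k := by positivity
  have h := Int.abs_sub_lt_one_of_floor_eq_floor (congrFun hxy i)
  rw [← sub_div, abs_div, abs_of_pos h2, div_lt_one h2] at h
  simpa using h

lemma disjoint_gridCell {k : ℤ} {m m' : Fin d → ℤ} (h : m ≠ m') :
    Disjoint (gridCell s k m) (gridCell s k m') :=
  Set.disjoint_left.2 fun _ hx hx' => h (hx.symm.trans hx')

lemma iUnion_gridCell (k : ℤ) : ⋃ m, gridCell s k m = univ :=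
  eq_univ_of_forall fun x => mem_iUnion.2 ⟨gridIdx s k x, rfl⟩

lemma gridCell_nonempty (k : ℤ) (m : Fin d → ℤ) : (gridCell s k m).Nonempty :=
  nonempty_of_measure_ne_zero (μ := volume) (by rw [volume_gridCell]; exact cellVol_ne_zero k)

lemma gridCell_subset {k l : ℤ} (h : k ≤ l) {x : Euc d} {m m' : Fin d → ℤ}
    (hx : x ∈ gridCell s k m) (hx' : x ∈ gridCell s l m') : gridCell s k m ⊆ gridCell s l m' :=
  fun _ hy => (gridIdx_eq_of_le s h (hy.trans (Eq.symm hx))).trans hx'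

end Grid

/-! ### Stopping levels -/

open Classical in
/-- The largest level `k` with `b < k < K` for which the cell of `x` is bad, and `b` if there is
none. -/
noncomputable def stopLevel {d : ℕ} (s : Fin d → ℝ) (bad : ℤ → (Fin d → ℤ) → Prop) {b K : ℤ}
    (hbK : b < K) (x : Euc d) : ℤ :=
  (Finset.Ico b K).sup' (Finset.nonempty_Ico.2 hbK)
    (fun l => if bad l (gridIdx s l x) then l else b)

section StopLevel

variable {d : ℕ} (s : Fin d → ℝ) (bad : ℤ → (Fin d → ℤ) → Prop) {b K : ℤ} (hbK : b < K)

lemma measurable_stopLevel : Measurable (stopLevel s bad hbK) := by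
  classical
  have h : stopLevel s bad hbK = (Finset.Ico b K).sup' (Finset.nonempty_Ico.2 hbK)
      (fun l (x : Euc d) => if bad l (gridIdx s l x) then l else b) := by
    funext x
    rw [Finset.sup'_apply, stopLevel]
  rw [h]
  refine Finset.measurable_sup' _ fun l _ => Measurable.ite ?_ measurable_const measurable_const
  exact measurable_gridIdx s l (MeasurableSet.of_discrete (s := {m | bad l m}))

lemma le_stopLevel (x : Euc d) : b ≤ stopLevel s bad hbK x := by
  classical
  refine Finset.le_sup'_of_le _ (Finset.left_mem_Ico.2 hbK) ?_
  split_ifs <;> rfl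

lemma stopLevel_lt (x : Euc d) : stopLevel s bad hbK x < K := by
  classical
  refine (Finset.sup'_lt_iff _).2 fun l hl => ?_
  rw [Finset.mem_Ico] at hl
  split_ifs
  exacts [hl.2, hbK]

lemma bad_stopLevel {x : Euc d} (h : b < stopLevel s bad hbK x) :
    bad (stopLevel s bad hbK x) (gridIdx s (stopLevel s bad hbK x) x) := by
  classical
  obtain ⟨l, -, h2⟩ := Finset.exists_mem_eq_sup' (Finset.nonempty_Ico.2 hbK)
    (fun l => if bad l (gridIdx s l x) then l else b)
  change stopLevel s bad hbK x = _ at h2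
  split_ifs at h2 with h3
  · rwa [h2]
  · omega

lemma not_bad_of_stopLevel_lt {x : Euc d} {l : ℤ} (h : stopLevel s bad hbK x < l) (hl : l < K) :
    ¬ bad l (gridIdx s l x) := by
  classical
  intro hb
  have h2 := (Finset.sup'_lt_iff _).1 h l
    (Finset.mem_Ico.2 ⟨(le_stopLevel s bad hbK x).trans h.le, hl⟩)
  simp [hb] at h2

/-- If `y` stopped above level `k`, its bad cell there would also contain `x`, which would then have
stopped at least as high. -/
lemma stopLevel_le_of_gridIdx_eq {x y : Euc d} {k : ℤ} (hxy : gridIdx s k x = gridIdx s k y)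
    (h : stopLevel s bad hbK x ≤ k) : stopLevel s bad hbK y ≤ k := by
  by_contra! h2
  have h3 := bad_stopLevel s bad hbK (((le_stopLevel s bad hbK x).trans h).trans_lt h2)
  rw [← gridIdx_eq_of_le s h2.le hxy] at h3
  exact not_bad_of_stopLevel_lt s bad hbK (h.trans_lt h2) (stopLevel_lt s bad hbK y) h3

lemma stopLevel_lt_of_gridIdx_eq {x y : Euc d} {k : ℤ} (hxy : gridIdx s k x = gridIdx s k y)
    (h : stopLevel s bad hbK x < k) : stopLevel s bad hbK y < k := by
  by_contra! h2
  have h3 := bad_stopLevel s bad hbK (((le_stopLevel s bad hbK x).trans_lt h).trans_le h2)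
  rw [← gridIdx_eq_of_le s h2 hxy] at h3
  exact not_bad_of_stopLevel_lt s bad hbK (h.trans_le h2) (stopLevel_lt s bad hbK y) h3

lemma stopLevel_eq_of_gridIdx_eq {x y : Euc d}
    (hxy : gridIdx s (stopLevel s bad hbK x) x = gridIdx s (stopLevel s bad hbK x) y) :
    stopLevel s bad hbK y = stopLevel s bad hbK x := by
  refine le_antisymm (stopLevel_le_of_gridIdx_eq s bad hbK hxy le_rfl) ?_
  by_contra! h2
  have h3 := bad_stopLevel s bad hbK ((le_stopLevel s bad hbK y).trans_lt h2)
  rw [hxy] at h3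
  exact not_bad_of_stopLevel_lt s bad hbK h2 (stopLevel_lt s bad hbK x) h3

end StopLevel

/-! ### Averages over dyadic cells and the Calderón–Zygmund pieces -/

/-- The average of `f` over the cell of level `k` containing `x`. -/
noncomputable def cellMean {d : ℕ} (s : Fin d → ℝ) (f : Euc d → ℂ) (k : ℤ) (x : Euc d) : ℂ :=
  ((cellVol d k).toReal : ℂ)⁻¹ * ∫ z in gridCell s k (gridIdx s k x), f z

/-- The piece with offset `n` at level `k` of the Calderón–Zygmund decomposition of `f` along the
stopping level `σ`: the good function for `n = 0`, and the sum of the bad functions on the stopping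
cells of level `k - n` for `n ≥ 1`. -/
noncomputable def czPiece {d : ℕ} (s : Fin d → ℝ) (σ : Euc d → ℤ) (f : Euc d → ℂ)
    (k : ℤ) (n : ℕ) (x : Euc d) : ℂ :=
  if n = 0 then cellMean s f (σ x) x
  else if σ x = k - n then f x - cellMean s f (σ x) x else 0

section Pieces

variable {d : ℕ} (s : Fin d → ℝ)

lemma cellMean_congr (f : Euc d → ℂ) {k : ℤ} {x y : Euc d} (h : gridIdx s k x = gridIdx s k y) :
    cellMean s f k x = cellMean s f k y := by
  rw [cellMean, cellMean, h]

lemma measurable_cellMean (f : Euc d → ℂ) (k : ℤ) : Measurable (cellMean s f k) :=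
  (measurable_of_countable fun m : Fin d → ℤ =>
    ((cellVol d k).toReal : ℂ)⁻¹ * ∫ z in gridCell s k m, f z).comp (measurable_gridIdx s k)

lemma measurable_cellMean_comp {σ : Euc d → ℤ} (hσ : Measurable σ) (f : Euc d → ℂ) :
    Measurable fun x => cellMean s f (σ x) x := by
  have h3 := measurable_cellMean s f
  generalize cellMean s f = F at h3 ⊢
  -- The level takes countably many values, so measurability in `x` at each level gives joint
  -- measurability.
  have h : Measurable (Function.uncurry F) := measurable_from_prod_countable_right h3
  exact h.comp (hσ.prodMk measurable_id)

lemma measurable_czPiece {σ : Euc d → ℤ} (hσ : Measurable σ) {f : Euc d → ℂ} (hf : Measurable f)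
    (k : ℤ) (n : ℕ) : Measurable (czPiece s σ f k n) := by
  have hm := measurable_cellMean_comp s hσ f
  by_cases hn : n = 0
  · have : czPiece s σ f k n = fun x => cellMean s f (σ x) x := by funext x; simp [czPiece, hn]
    rwa [this]
  · have : czPiece s σ f k n = fun x => if σ x = k - n then f x - cellMean s f (σ x) x else 0 := by
      funext x; simp [czPiece, hn]
    rw [this]
    exact Measurable.ite (hσ (measurableSet_singleton _)) (hf.sub hm) measurable_const

/-- At a point only the offsets `0` and `k - σ x` contribute, namely the mean and `f` minus the
mean. The hypothesis `h` keeps these offsets distinct. -/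
lemma sum_czPiece {σ : Euc d → ℤ} (f : Euc d → ℂ) {k : ℤ} {N : ℕ} {x : Euc d} (h : σ x < k)
    (hN : k - σ x < N) : ∑ n ∈ Finset.range N, czPiece s σ f k n x = f x := by
  obtain ⟨j, hj⟩ := Int.le.dest h.le
  have h0 : 0 ∈ Finset.range N := by simp; omega
  rw [← Finset.add_sum_erase _ _ h0, Finset.sum_eq_single j]
  · rw [czPiece, czPiece, if_pos rfl, if_neg (by omega), if_pos (by omega)]
    ring
  · intro n hn hnj
    rw [Finset.mem_erase] at hn
    rw [czPiece, if_neg hn.1, if_neg (by omega)]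
  · intro hj2
    exact absurd (by simp; omega) hj2

/-- Monotonicity of `L^p` norms in `p` for the normalized measure on the cell. -/
lemma enorm_cellMean_le (f : Euc d → ℂ) (hf : Measurable f) {p : ℝ} (hp : 1 ≤ p) (k : ℤ)
    (x : Euc d) : ‖cellMean s f k x‖ₑ ≤
      ((cellVol d k)⁻¹ * ∫⁻ z in gridCell s k (gridIdx s k x), ‖f z‖ₑ ^ p) ^ (1 / p) := by
  set Q := gridCell s k (gridIdx s k x)
  have hv0 := cellVol_ne_zero (d := d) k
  have hvt := cellVol_ne_top (d := d) k
  have h1 : ‖cellMean s f k x‖ₑ ≤ ∫⁻ z, ‖f z‖ₑ ∂((cellVol d k)⁻¹ • volume.restrict Q) := by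
    rw [lintegral_smul_measure, cellMean, enorm_mul, smul_eq_mul]
    gcongr
    · rw [enorm_inv (by simp [ENNReal.toReal_eq_zero_iff, hv0, hvt])]
      gcongr
      simp [← ofReal_norm, ENNReal.ofReal_toReal hvt]
    · exact enorm_integral_le_lintegral_enorm _
  have : IsProbabilityMeasure ((cellVol d k)⁻¹ • volume.restrict Q) := by
    constructor
    simp only [Measure.smul_apply, Measure.restrict_apply_univ, smul_eq_mul, Q, volume_gridCell]
    exact ENNReal.inv_mul_cancel hv0 hvt
  have h2 := eLpNorm'_le_eLpNorm'_of_exponent_le (p := 1) (q := p) one_pos hp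
    ((cellVol d k)⁻¹ • volume.restrict Q) hf.aestronglyMeasurable
  simp only [eLpNorm', lintegral_smul_measure, ENNReal.rpow_one, div_one, smul_eq_mul] at h2
  rw [lintegral_smul_measure, smul_eq_mul] at h1
  simpa using h1.trans h2

end Pieces

/-! ### Representation by differences of translates -/

/-- On `Q`, the function `U` is a superposition of differences `(I - τ_y) u_y` with `‖y‖ ≤ ρ`, with
respect to a measure of mass at most `W`, where `u_y` is supported in `Q` and dominated by `U`. -/
def HasShiftRep {d : ℕ} (Q : Set (Euc d)) (U : Euc d → ℂ) (ρ : ℝ) (W : ℝ≥0∞) : Prop :=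
  ∃ (ν : Measure (Euc d)) (u : Euc d → Euc d → ℂ), Measurable (Function.uncurry u) ∧
    (∀ y z, ‖u y z‖ₑ ≤ Q.indicator (fun z => ‖U z‖ₑ) z) ∧ (∀ᵐ y ∂ν, ‖y‖ ≤ ρ) ∧ ν univ ≤ W ∧
    ∀ z ∈ Q, U z = ∫ y, subTranslate y (u y) z ∂ν

section ShiftRep

variable {d : ℕ}

lemma HasShiftRep.mono {Q : Set (Euc d)} {U : Euc d → ℂ} {ρ ρ' : ℝ} {W W' : ℝ≥0∞}
    (h : HasShiftRep Q U ρ W) (hρ : ρ ≤ ρ') (hW : W ≤ W') : HasShiftRep Q U ρ' W' := by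
  obtain ⟨ν, u, h1, h2, h3, h4, h5⟩ := h
  exact ⟨ν, u, h1, h2, h3.mono fun y hy => hy.trans hρ, h4.trans hW, h5⟩

/-- No cancellation is needed here: a shift by one full side length moves the cell off itself, so
the translate of `1_Q U` vanishes on `Q`. This lets the good part go through the same estimate as
the bad parts, without decay. -/
lemma hasShiftRep_gridCell (hd : 0 < d) (s : Fin d → ℝ) (k : ℤ) (m : Fin d → ℤ) {U : Euc d → ℂ}
    (hU : Measurable U) : HasShiftRep (gridCell s k m) U ((2 : ℝ) ^ k) 1 := by
  have h2 : (0 : ℝ) < (2 : ℝ) ^ k := by positivity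
  let e : Euc d := EuclideanSpace.single ⟨0, hd⟩ ((2 : ℝ) ^ k)
  refine ⟨Measure.dirac e, fun _ => (gridCell s k m).indicator U, ?_, ?_, ?_, by simp, ?_⟩
  · exact (hU.indicator (measurableSet_gridCell s k m)).comp measurable_snd
  · intro y z
    by_cases hz : z ∈ gridCell s k m <;> simp [hz]
  · rw [ae_dirac_iff (measurableSet_le measurable_norm measurable_const)]
    simp [e]
  · intro z hz
    have hz2 : z - e ∉ gridCell s k m := by
      intro h
      have := abs_sub_lt_of_gridIdx_eq s (Eq.trans hz h.symm) ⟨0, hd⟩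
      simp [e, abs_of_pos h2] at this
    rw [integral_dirac]
    simp [subTranslate, hz, hz2]

lemma norm_le_of_forall_abs_le {y : Euc d} {l : ℝ} (hl : 0 ≤ l) (h : ∀ i, |y i| ≤ l) :
    ‖y‖ ≤ d * l := by
  refine abs_le_of_sq_le_sq' ?_ (by positivity) |>.2
  rw [EuclideanSpace.norm_eq, Real.sq_sqrt (by positivity)]
  have h1 : ∑ i, ‖y i‖ ^ 2 ≤ ∑ _i : Fin d, l ^ 2 := by
    gcongr with i
    exact h i
  refine h1.trans ?_
  simp only [Finset.sum_const, Finset.card_univ, Fintype.card_fin, nsmul_eq_mul, mul_pow]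
  gcongr
  exact_mod_cast Nat.le_self_pow two_ne_zero d

/-- Let `P` be the cell of level `l` containing `z`. Mean zero gives `U z = |P|⁻¹ ∫_P (U z - U z')
dz'`. Substituting `z' = z - y` in the second term, and letting `u_y` be `U` restricted to those
points which `+ y` keeps in their cell, turns this into an average of `(I - τ_y) u_y`. The shifts
range over a box of volume `2 ^ d |P|`, whence the mass. -/
lemma hasShiftRep_of_integral_eq_zero (s : Fin d → ℝ) {k l : ℤ} (hlk : l ≤ k) (m : Fin d → ℤ)
    {U : Euc d → ℂ} (hU : Measurable U) {N : ℝ} (hN : ∀ z, ‖U z‖ ≤ N)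
    (h0 : ∀ m', ∫ z in gridCell s l m', U z = 0) :
    HasShiftRep (gridCell s k m) U (d * (2 : ℝ) ^ l) (2 ^ d) := by
  have h2 : (0 : ℝ) < (2 : ℝ) ^ l := by positivity
  set Q := gridCell s k m
  have hQ : MeasurableSet Q := measurableSet_gridCell s k m
  have hv0 := cellVol_ne_zero (d := d) l
  have hvt := cellVol_ne_top (d := d) l
  -- This box contains every difference of two points in a common cell of level `l`, so the
  -- integrals over `A` below equal integrals over the whole space.
  let A : Set (Euc d) := {y | ∀ i, y i ∈ Ico (-(2 : ℝ) ^ l) (-(2 : ℝ) ^ l + 2 * 2 ^ l)}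
  have hA : MeasurableSet A := by
    have : A = ⋂ i, {y : Euc d | y i ∈ Ico (-(2 : ℝ) ^ l) (-(2 : ℝ) ^ l + 2 * 2 ^ l)} := by
      ext; simp [A]
    rw [this]
    exact MeasurableSet.iInter fun i => (by fun_prop : Measurable fun y : Euc d => y i)
      measurableSet_Ico
  have hvA : volume A = 2 ^ d * cellVol d l := by
    rw [volume_box, ENNReal.ofReal_mul zero_le_two, mul_pow, cellVol]
    simp
  have hmemA : ∀ z z' : Euc d, gridIdx s l z = gridIdx s l z' → z - z' ∈ A := by
    intro z z' h i
    have := abs_lt.1 (abs_sub_lt_of_gridIdx_eq s h i)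
    simp only [PiLp.sub_apply, mem_Ico]
    constructor <;> linarith
  have hg := measurable_gridIdx s l
  let T : Set (Euc d × Euc d) := {w | w.2 ∈ Q ∧ gridIdx s l w.2 = gridIdx s l (w.2 + w.1)}
  have hT : MeasurableSet T := by
    refine MeasurableSet.inter (measurable_snd hQ) ?_
    exact measurableSet_eq_fun (hg.comp measurable_snd)
      (hg.comp (measurable_snd.add measurable_fst))
  let u : Euc d → Euc d → ℂ := fun y z => T.indicator (fun w => U w.2) (y, z)
  have hu : Measurable (Function.uncurry u) := (hU.comp measurable_snd).indicator hT
  have hu1 : ∀ y z, ‖u y z‖ₑ ≤ Q.indicator (fun z => ‖U z‖ₑ) z := by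
    intro y z
    by_cases h : (y, z) ∈ T
    · simp only [u, indicator_of_mem h, indicator_of_mem h.1]; rfl
    · simp only [u, indicator_of_notMem h]; simp
  have huN : ∀ y z, ‖u y z‖ ≤ N := by
    intro y z
    by_cases h : (y, z) ∈ T
    · simp only [u, indicator_of_mem h]; exact hN z
    · simp only [u, indicator_of_notMem h, norm_zero]; exact (norm_nonneg _).trans (hN z)
  have hfin : IsFiniteMeasure (volume.restrict A) :=
    ⟨by rw [Measure.restrict_apply_univ, hvA]; exact ENNReal.mul_lt_top (by simp) hvt.lt_top⟩
  refine ⟨(cellVol d l)⁻¹ • volume.restrict A, u, hu, hu1, ?_, ?_, ?_⟩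
  · refine Measure.ae_smul_measure ?_ _
    filter_upwards [ae_restrict_mem hA] with y hy
    refine norm_le_of_forall_abs_le h2.le fun i => abs_le.2 ⟨(hy i).1, ?_⟩
    linarith [(hy i).2]
  · simp only [Measure.smul_apply, Measure.restrict_apply_univ, smul_eq_mul, hvA]
    rw [mul_left_comm, ENNReal.inv_mul_cancel hv0 hvt, mul_one]
  · intro z hz
    set P := gridCell s l (gridIdx s l z)
    have hP : MeasurableSet P := measurableSet_gridCell s l _
    have hPQ : P ⊆ Q := gridCell_subset s hlk rfl hz
    have e1 : ∀ y, u y z = P.indicator (fun _ => U z) (z + y) := by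
      intro y
      have : (y, z) ∈ T ↔ z + y ∈ P := ⟨fun h => h.2.symm, fun h => ⟨hz, h.symm⟩⟩
      by_cases h : z + y ∈ P
      · simp only [u, indicator_of_mem h, indicator_of_mem (this.2 h)]
      · simp only [u, indicator_of_notMem h, indicator_of_notMem (mt this.1 h)]
    have e2 : ∀ y, u y (z - y) = P.indicator U (z - y) := by
      intro y
      have : (y, z - y) ∈ T ↔ z - y ∈ P :=
        ⟨fun h => by simpa [P, gridCell] using h.2,
          fun h => ⟨hPQ h, by simpa [P, gridCell] using h⟩⟩
      by_cases h : z - y ∈ P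
      · simp only [u, indicator_of_mem h, indicator_of_mem (this.2 h)]
      · simp only [u, indicator_of_notMem h, indicator_of_notMem (mt this.1 h)]
    have i1 : Integrable (fun y => u y z) (volume.restrict A) :=
      Integrable.of_bound (hu.comp measurable_prodMk_right).aestronglyMeasurable N
        (ae_of_all _ fun y => huN y z)
    have i2 : Integrable (fun y => u y (z - y)) (volume.restrict A) :=
      Integrable.of_bound
        (hu.comp (measurable_id.prodMk (measurable_const.sub measurable_id))).aestronglyMeasurable N
        (ae_of_all _ fun y => huN y (z - y))
    have j1 : ∫ y in A, u y z = ((cellVol d l).toReal : ℂ) * U z := by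
      rw [setIntegral_eq_integral_of_forall_compl_eq_zero]
      · simp_rw [e1]
        rw [integral_add_left_eq_self (fun y => P.indicator (fun _ => U z) y) z,
          integral_indicator hP, setIntegral_const]
        simp [P, measureReal_def, volume_gridCell]
      · intro y hy
        rw [e1, indicator_of_notMem]
        intro h
        exact hy (by simpa using hmemA _ z h)
    have j2 : ∫ y in A, u y (z - y) = 0 := by
      rw [setIntegral_eq_integral_of_forall_compl_eq_zero]
      · simp_rw [e2]
        rw [integral_sub_left_eq_self (fun y => P.indicator U y) volume z,
          integral_indicator hP, h0]
      · intro y hy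
        rw [e2, indicator_of_notMem]
        intro h
        exact hy (by simpa using hmemA z _ h.symm)
    simp only [subTranslate]
    rw [integral_smul_measure, integral_sub i1 i2, j1, j2, sub_zero, ENNReal.toReal_inv,
      Complex.real_smul, Complex.ofReal_inv, inv_mul_cancel_left₀]
    simp [ENNReal.toReal_eq_zero_iff, hv0, hvt]

end ShiftRep

/-! ### The localized estimate -/

/-- Hölder's inequality against the constant `1`. -/
lemma rpow_lintegral_le {α : Type*} [MeasurableSpace α] (ν : Measure α) {r : ℝ} (hr : 1 < r)
    {F : α → ℝ≥0∞} (hF : AEMeasurable F ν) :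
    (∫⁻ y, F y ∂ν) ^ r ≤ ν univ ^ (r - 1) * ∫⁻ y, F y ^ r ∂ν := by
  have hr0 : 0 < r := by linarith
  have hc := Real.HolderConjugate.conjExponent hr
  have h := ENNReal.lintegral_mul_le_Lp_mul_Lq ν hc hF (g := 1) aemeasurable_const
  simp only [mul_one, Pi.one_apply, ENNReal.one_rpow, lintegral_const, one_mul] at h
  calc (∫⁻ y, F y ∂ν) ^ r ≤ ((∫⁻ y, F y ^ r ∂ν) ^ (1 / r) * ν univ ^ (1 / r.conjExponent)) ^ r := by
        gcongr
    _ = ν univ ^ (r - 1) * ∫⁻ y, F y ^ r ∂ν := by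
        rw [ENNReal.mul_rpow_of_nonneg _ _ hr0.le, ← ENNReal.rpow_mul, ← ENNReal.rpow_mul,
          one_div_mul_cancel hr0.ne', ENNReal.rpow_one, mul_comm]
        congr 2
        have : r - 1 ≠ 0 := by linarith
        simp only [Real.conjExponent]
        field_simp

section Local

variable {d : ℕ} (μ : Measure (Euc d × Euc d)) [IsFiniteMeasure μ]

/-- By bilinearity and Fubini, `L_t(U, V)` is on `A` a superposition over pairs `(y₁, y₂)` of terms
to which `hest` applies. The `r`-th power is moved inside at the cost of a power of the total mass.
Since `u_y` and `v_y` live on `Q`, only the norms of `U` and `V` over `Q` appear. -/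
lemma lintegral_bilinConv_rpow_le_of_shiftRep {p q r : ℝ} (hp : 0 < p) (hq : 0 < q) (hr : 1 < r)
    {t : ℝ} {κ : ℝ → ℝ → ℝ}
    (hκ : ∀ a b a' b', 0 ≤ a → a ≤ a' → 0 ≤ b → b ≤ b' → κ a b ≤ κ a' b')
    (hest : ∀ (y₁ y₂ : Euc d) (f g : Euc d → ℂ), MemLp f (ENNReal.ofReal p) volume →
      MemLp g (ENNReal.ofReal q) volume →
      eLpNorm (bilinConv μ t (subTranslate y₁ f) (subTranslate y₂ g)) (ENNReal.ofReal r) volume ≤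
        ENNReal.ofReal (κ ‖y₁‖ ‖y₂‖) *
        eLpNorm f (ENNReal.ofReal p) volume * eLpNorm g (ENNReal.ofReal q) volume)
    {Q A : Set (Euc d)} (hQ : MeasurableSet Q) (hQv : volume Q ≠ ∞)
    (hA : ∀ x ∈ A, ∀ᵐ w ∂μ, x - t • w.1 ∈ Q ∧ x - t • w.2 ∈ Q) {U V : Euc d → ℂ} {N : ℝ}
    (hU : ∀ z, ‖U z‖ ≤ N) (hV : ∀ z, ‖V z‖ ≤ N) {ρ₁ ρ₂ : ℝ} {W₁ W₂ : ℝ≥0∞}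
    (hW₁ : W₁ ≠ ∞) (hW₂ : W₂ ≠ ∞)
    (hUr : HasShiftRep Q U ρ₁ W₁) (hVr : HasShiftRep Q V ρ₂ W₂) (hAm : MeasurableSet A) :
    ∫⁻ x in A, ‖bilinConv μ t U V x‖ₑ ^ r ≤
      (W₁ * W₂ * ENNReal.ofReal (κ ρ₁ ρ₂)) ^ r * (∫⁻ z in Q, ‖U z‖ₑ ^ p) ^ (r / p) *
        (∫⁻ z in Q, ‖V z‖ₑ ^ q) ^ (r / q) := by
  have hr0 : 0 < r := by linarith
  obtain ⟨ν₁, u, hu, hub, hν₁, hW1, hUu⟩ := hUr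
  obtain ⟨ν₂, v, hv, hvb, hν₂, hW2, hVv⟩ := hVr
  have : IsFiniteMeasure ν₁ := ⟨hW1.trans_lt hW₁.lt_top⟩
  have : IsFiniteMeasure ν₂ := ⟨hW2.trans_lt hW₂.lt_top⟩
  have bound : ∀ {U : Euc d → ℂ} {u : Euc d → Euc d → ℂ}, (∀ z, ‖U z‖ ≤ N) →
      (∀ y z, ‖u y z‖ₑ ≤ Q.indicator (fun z => ‖U z‖ₑ) z) → ∀ y z, ‖u y z‖ ≤ N := by
    intro U u hU hu y z
    have h1 : ‖u y z‖ₑ ≤ ‖U z‖ₑ := (hu y z).trans (indicator_le_self _ _ z)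
    exact (enorm_le_iff_norm_le.1 h1).trans (hU z)
  have huN := bound hU hub
  have hvN := bound hV hvb
  have memLp : ∀ {U : Euc d → ℂ} {u : Euc d → Euc d → ℂ} {p : ℝ}, 0 < p → (∀ z, ‖U z‖ ≤ N) →
      Measurable (Function.uncurry u) →
      (∀ y z, ‖u y z‖ₑ ≤ Q.indicator (fun z => ‖U z‖ₑ) z) → ∀ y,
      eLpNorm (u y) (ENNReal.ofReal p) volume ≤ (∫⁻ z in Q, ‖U z‖ₑ ^ p) ^ (1 / p) ∧
        MemLp (u y) (ENNReal.ofReal p) volume := by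
    intro U u p hp hU hum hu y
    have e1 : eLpNorm (u y) (ENNReal.ofReal p) volume ≤ (∫⁻ z in Q, ‖U z‖ₑ ^ p) ^ (1 / p) := by
      rw [eLpNorm_eq_lintegral_rpow_enorm_toReal (by simpa using hp) (by simp),
        ENNReal.toReal_ofReal hp.le, ← lintegral_indicator hQ]
      gcongr with z
      refine (ENNReal.rpow_le_rpow (hu y z) hp.le).trans (le_of_eq ?_)
      by_cases hz : z ∈ Q <;> simp [hz, hp]
    refine ⟨e1, (hum.comp measurable_prodMk_left).aestronglyMeasurable, e1.trans_lt ?_⟩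
    refine ENNReal.rpow_lt_top_of_nonneg (by positivity) (ne_of_lt ?_)
    calc ∫⁻ z in Q, ‖U z‖ₑ ^ p ≤ ∫⁻ _ in Q, ENNReal.ofReal N ^ p := by
          gcongr with z
          rw [← ofReal_norm]
          exact ENNReal.ofReal_le_ofReal (hU z)
      _ < ∞ := by
          rw [setLIntegral_const]
          exact ENNReal.mul_lt_top (ENNReal.rpow_lt_top_of_nonneg hp.le ENNReal.ofReal_ne_top)
            hQv.lt_top
  let G : Euc d × Euc d → Euc d → ℂ := fun y x =>
    bilinConv μ t (subTranslate y.1 (u y.1)) (subTranslate y.2 (v y.2)) x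
  let H : (Euc d × Euc d) × Euc d → Euc d × Euc d → ℂ := fun a w =>
    subTranslate a.1.1 (u a.1.1) (a.2 - t • w.1) * subTranslate a.1.2 (v a.1.2) (a.2 - t • w.2)
  have hH : Measurable (Function.uncurry H) := by
    simp only [H, Function.uncurry_def, subTranslate]
    have c1 : ∀ {u : Euc d → Euc d → ℂ}, Measurable (Function.uncurry u) →
        ∀ {X Y : ((Euc d × Euc d) × Euc d) × (Euc d × Euc d) → Euc d}, Measurable X →
        Measurable Y → Measurable fun a => u (X a) (Y a) :=
      fun hu _ _ hX hY => hu.comp (hX.prodMk hY)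
    refine Measurable.mul (Measurable.sub (c1 hu ?_ ?_) (c1 hu ?_ ?_))
      (Measurable.sub (c1 hv ?_ ?_) (c1 hv ?_ ?_)) <;> fun_prop
  have hHb : ∀ a w, ‖H a w‖ ≤ (N + N) * (N + N) := by
    intro a w
    simp only [H, subTranslate, norm_mul]
    have hN0 : 0 ≤ N := (norm_nonneg _).trans (hU 0)
    gcongr
    · exact (norm_sub_le _ _).trans (add_le_add (huN _ _) (huN _ _))
    · exact (norm_sub_le _ _).trans (add_le_add (hvN _ _) (hvN _ _))
  have hGm : StronglyMeasurable (Function.uncurry G) := by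
    have := hH.stronglyMeasurable.integral_prod_right (ν := μ)
    exact this
  -- The representations of `U` and `V` hold only on `Q`, which is why `x` is restricted to `A`.
  -- Fubini applies to a bounded integrand on finite measures.
  have hrep : ∀ x ∈ A, bilinConv μ t U V x = ∫ y, G y x ∂(ν₁.prod ν₂) := by
    intro x hx
    have e1 : bilinConv μ t U V x = ∫ w, ∫ y, H (y, x) w ∂(ν₁.prod ν₂) ∂μ := by
      refine integral_congr_ae ?_
      filter_upwards [hA x hx] with w hw
      rw [hUu _ hw.1, hVv _ hw.2, ← integral_prod_mul]
    rw [e1, integral_integral_swap]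
    · rfl
    · refine Integrable.of_bound (C := (N + N) * (N + N)) ?_ (ae_of_all _ fun a => hHb _ _)
      refine Measurable.aestronglyMeasurable ?_
      have : Measurable fun a : (Euc d × Euc d) × (Euc d × Euc d) => ((a.2, x), a.1) := by fun_prop
      exact hH.comp this
  set ν := ν₁.prod ν₂
  have hνuniv : ν univ ≤ W₁ * W₂ := by
    rw [← univ_prod_univ, Measure.prod_prod]
    gcongr
  have hGe : Measurable (Function.uncurry fun x y => ‖G y x‖ₑ ^ r) := by
    have := hGm.measurable.comp (measurable_swap (α := Euc d) (β := Euc d × Euc d))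
    exact (this.enorm).pow_const r
  have hGy : ∀ x, Measurable fun y => ‖G y x‖ₑ := fun x =>
    (hGm.measurable.comp measurable_prodMk_right).enorm
  set IU := (∫⁻ z in Q, ‖U z‖ₑ ^ p) with hIU
  set IV := (∫⁻ z in Q, ‖V z‖ₑ ^ q) with hIV
  have hnorm : ∀ᵐ y ∂ν, ∫⁻ x, ‖G y x‖ₑ ^ r ≤
      ENNReal.ofReal (κ ρ₁ ρ₂) ^ r * IU ^ (r / p) * IV ^ (r / q) := by
    have h1 : ∀ᵐ y ∂ν, ‖y.1‖ ≤ ρ₁ := Measure.quasiMeasurePreserving_fst.ae hν₁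
    have h2 : ∀ᵐ y ∂ν, ‖y.2‖ ≤ ρ₂ := Measure.quasiMeasurePreserving_snd.ae hν₂
    filter_upwards [h1, h2] with y hy1 hy2
    obtain ⟨a1, a2⟩ := memLp hp hU hu hub y.1
    obtain ⟨b1, b2⟩ := memLp hq hV hv hvb y.2
    have h3 := hest y.1 y.2 _ _ a2 b2
    rw [eLpNorm_eq_lintegral_rpow_enorm_toReal (by simpa using hr0) (by simp),
        ENNReal.toReal_ofReal hr0.le] at h3
    have h4 : (∫⁻ x, ‖G y x‖ₑ ^ r) ^ (1 / r) ≤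
        ENNReal.ofReal (κ ρ₁ ρ₂) * IU ^ (1 / p) * IV ^ (1 / q) := by
      refine h3.trans ?_
      gcongr
      exact hκ _ _ _ _ (norm_nonneg _) hy1 (norm_nonneg _) hy2
    have h5 := ENNReal.rpow_le_rpow h4 hr0.le
    rw [← ENNReal.rpow_mul, one_div_mul_cancel hr0.ne', ENNReal.rpow_one,
      ENNReal.mul_rpow_of_nonneg _ _ hr0.le, ENNReal.mul_rpow_of_nonneg _ _ hr0.le,
      ← ENNReal.rpow_mul, ← ENNReal.rpow_mul] at h5
    convert h5 using 4 <;> ring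
  calc ∫⁻ x in A, ‖bilinConv μ t U V x‖ₑ ^ r
      ≤ ∫⁻ x in A, ν univ ^ (r - 1) * ∫⁻ y, ‖G y x‖ₑ ^ r ∂ν := by
        refine setLIntegral_mono' hAm fun x hx => ?_
        rw [hrep x hx]
        refine (ENNReal.rpow_le_rpow (enorm_integral_le_lintegral_enorm _) hr0.le).trans ?_
        exact rpow_lintegral_le ν hr (hGy x).aemeasurable
    _ ≤ ∫⁻ x, ν univ ^ (r - 1) * ∫⁻ y, ‖G y x‖ₑ ^ r ∂ν := setLIntegral_le_lintegral _ _
    _ = ν univ ^ (r - 1) * ∫⁻ y, (∫⁻ x, ‖G y x‖ₑ ^ r) ∂ν := by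
        rw [lintegral_const_mul _ hGe.lintegral_prod_right, lintegral_lintegral_swap]
        exact hGe.aemeasurable
    _ ≤ ν univ ^ (r - 1) * ∫⁻ _, ENNReal.ofReal (κ ρ₁ ρ₂) ^ r * IU ^ (r / p) * IV ^ (r / q) ∂ν := by
        gcongr 1
        exact lintegral_mono_ae hnorm
    _ = ν univ ^ r * (ENNReal.ofReal (κ ρ₁ ρ₂) ^ r * IU ^ (r / p) * IV ^ (r / q)) := by
        rw [lintegral_const, mul_comm (_ * _ * _) (ν univ), ← mul_assoc]
        congr 1
        conv_lhs => rw [← ENNReal.rpow_one (ν univ), ← ENNReal.rpow_mul, one_mul]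
        rw [← ENNReal.rpow_add_of_nonneg _ _ (by linarith) zero_le_one]
        congr 1; ring
    _ ≤ (W₁ * W₂) ^ r * (ENNReal.ofReal (κ ρ₁ ρ₂) ^ r * IU ^ (r / p) * IV ^ (r / q)) := by
        gcongr
    _ = _ := by
        rw [ENNReal.mul_rpow_of_nonneg (W₁ * W₂) _ hr0.le]
        ring

end Local

/-! ### Size of the Calderón–Zygmund pieces -/

section PieceBounds

variable {d : ℕ} (s : Fin d → ℝ) (bad : ℤ → (Fin d → ℤ) → Prop) {b K : ℤ} (hbK : b < K)

/-- The level `k` averages of `‖f‖ ^ p` over the cells in the top cell which are not contained in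
a stopping cell are at most `c`. -/
def StoppedBound (m₀ : Fin d → ℤ) (f : Euc d → ℂ) (p : ℝ) (c : ℝ≥0∞) : Prop :=
  ∀ x ∈ gridCell s K m₀, ∀ k, stopLevel s bad hbK x < k → k ≤ K →
    ∫⁻ z in gridCell s k (gridIdx s k x), ‖f z‖ₑ ^ p ≤ c * cellVol d k

lemma norm_cellMean_le {f : Euc d → ℂ} {N : ℝ} (hN : ∀ z, ‖f z‖ ≤ N) (k : ℤ) (x : Euc d) :
    ‖cellMean s f k x‖ ≤ N := by
  have hv : 0 < (cellVol d k).toReal :=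
    ENNReal.toReal_pos (cellVol_ne_zero k) (cellVol_ne_top k)
  have h : ‖∫ z in gridCell s k (gridIdx s k x), f z‖ ≤ N * (cellVol d k).toReal := by
    have h1 := norm_setIntegral_le_of_norm_le_const (μ := volume)
      (s := gridCell s k (gridIdx s k x)) (f := f) (C := N)
      (by rw [volume_gridCell]; exact (cellVol_ne_top k).lt_top) (fun z _ => hN z)
    rwa [measureReal_def, volume_gridCell] at h1
  rw [cellMean, norm_mul, norm_inv, Complex.norm_real, Real.norm_of_nonneg hv.le,
    inv_mul_le_iff₀ hv, mul_comm]
  exact h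

lemma norm_czPiece_le (σ : Euc d → ℤ) {f : Euc d → ℂ} {N : ℝ} (hN : ∀ z, ‖f z‖ ≤ N) (k : ℤ)
    (n : ℕ) (x : Euc d) : ‖czPiece s σ f k n x‖ ≤ N + N := by
  have h1 := norm_cellMean_le s hN (σ x) x
  have hN0 := (norm_nonneg _).trans h1
  rw [czPiece]
  split_ifs
  · linarith
  · exact (norm_sub_le _ _).trans (add_le_add (hN x) h1)
  · simpa using by linarith

variable {m₀ : Fin d → ℤ} {f : Euc d → ℂ} {p : ℝ} {c : ℝ≥0∞}

/-- The parent of a stopping cell is still controlled, and its volume is `2 ^ d` times larger. This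
also covers the points where nothing stops and the level is `b`. -/
lemma enorm_cellMean_stopLevel_rpow_le (hc : StoppedBound s bad hbK m₀ f p c) (hf : Measurable f)
    (hp : 1 ≤ p) {x : Euc d} (hx : x ∈ gridCell s K m₀) :
    ‖cellMean s f (stopLevel s bad hbK x) x‖ₑ ^ p ≤ 2 ^ d * c := by
  set k := stopLevel s bad hbK x with hk
  have hp0 : 0 < p := by linarith
  have h1 := ENNReal.rpow_le_rpow (enorm_cellMean_le s f hf hp k x) hp0.le
  rw [← ENNReal.rpow_mul, one_div_mul_cancel hp0.ne', ENNReal.rpow_one] at h1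
  have h2 : ∫⁻ z in gridCell s k (gridIdx s k x), ‖f z‖ₑ ^ p ≤ c * cellVol d (k + 1) := by
    refine le_trans ?_ (hc x hx (k + 1) (by omega) (by have := stopLevel_lt s bad hbK x; omega))
    exact lintegral_mono_set (gridCell_subset s (by omega) rfl rfl)
  refine h1.trans ?_
  rw [ENNReal.inv_mul_le_iff (cellVol_ne_zero k) (cellVol_ne_top k)]
  refine h2.trans (le_of_eq ?_)
  rw [cellVol_succ]
  ring

lemma enorm_czPiece_rpow_le (hc : StoppedBound s bad hbK m₀ f p c) (hf : Measurable f)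
    (hp : 1 ≤ p) {x : Euc d} (hx : x ∈ gridCell s K m₀) (k : ℤ) {n : ℕ} (hn : n ≠ 0) :
    ‖czPiece s (stopLevel s bad hbK) f k n x‖ₑ ^ p ≤
      {x | stopLevel s bad hbK x = k - n}.indicator
        (fun x => 2 ^ p * (‖f x‖ₑ ^ p + 2 ^ d * c)) x := by
  have hp0 : 0 < p := by linarith
  rw [czPiece, if_neg hn]
  by_cases h : stopLevel s bad hbK x = k - n
  · rw [if_pos h, indicator_of_mem (show x ∈ {x | stopLevel s bad hbK x = k - n} from h)]
    have h1 := enorm_cellMean_stopLevel_rpow_le s bad hbK hc hf hp hx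
    have h3 := ENNReal.rpow_add_le_mul_rpow_add_rpow ‖f x‖ₑ
      ‖cellMean s f (stopLevel s bad hbK x) x‖ₑ hp
    calc _ ≤ (‖f x‖ₑ + ‖cellMean s f (stopLevel s bad hbK x) x‖ₑ) ^ p := by
          gcongr
          exact enorm_sub_le
      _ ≤ _ := h3
      _ ≤ _ := by
          gcongr
          · exact one_le_two
          · linarith
  · rw [if_neg h]
    simp [hp0]

/-- For a fixed offset `n ≠ 0` the pieces at different levels `k` sit on the disjoint sets where the
stopping level is `k - n`, so the whole sum costs a single integral over the top cell. -/
lemma sum_lintegral_czPiece_le (hc : StoppedBound s bad hbK m₀ f p c) (hf : Measurable f)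
    (hp : 1 ≤ p) {n : ℕ} (hn : n ≠ 0) :
    ∑ k ∈ Finset.Ioc b K, ∫⁻ x in gridCell s K m₀,
      ‖czPiece s (stopLevel s bad hbK) f k n x‖ₑ ^ p ≤
        2 ^ p * (2 ^ (d + 1) * c) * cellVol d K := by
  have hσ := measurable_stopLevel s bad hbK
  have hQ := measurableSet_gridCell s K m₀
  have hS : ∀ k : ℤ, MeasurableSet {x | stopLevel s bad hbK x = k - n} := fun k =>
    hσ (measurableSet_singleton _)
  have hφ : Measurable fun x => 2 ^ p * (‖f x‖ₑ ^ p + 2 ^ d * c) := by fun_prop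
  calc _ ≤ ∑ k ∈ Finset.Ioc b K, ∫⁻ x in gridCell s K m₀,
          {x | stopLevel s bad hbK x = k - n}.indicator
            (fun x => 2 ^ p * (‖f x‖ₑ ^ p + 2 ^ d * c)) x := by
        refine Finset.sum_le_sum fun k _ => ?_
        exact setLIntegral_mono' hQ fun x hx => enorm_czPiece_rpow_le s bad hbK hc hf hp hx k hn
    _ = ∫⁻ x in gridCell s K m₀, ∑ k ∈ Finset.Ioc b K,
          {x | stopLevel s bad hbK x = k - n}.indicator
            (fun x => 2 ^ p * (‖f x‖ₑ ^ p + 2 ^ d * c)) x :=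
        (lintegral_finsetSum _ fun k _ => hφ.indicator (hS k)).symm
    _ ≤ ∫⁻ x in gridCell s K m₀, 2 ^ p * (‖f x‖ₑ ^ p + 2 ^ d * c) := by
        gcongr with x
        by_cases h : stopLevel s bad hbK x + n ∈ Finset.Ioc b K
        · rw [Finset.sum_eq_single_of_mem _ h]
          · exact indicator_le_self _ _ x
          · intro k _ hk
            rw [indicator_of_notMem]
            intro (h' : _ = _)
            omega
        · rw [Finset.sum_eq_zero]
          · exact zero_le
          · intro k hk
            rw [indicator_of_notMem]
            intro (h' : _ = _)
            exact h (by rw [h']; simpa using hk)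
    _ = 2 ^ p * ((∫⁻ x in gridCell s K m₀, ‖f x‖ₑ ^ p) + 2 ^ d * c * cellVol d K) := by
        rw [lintegral_const_mul _ (by fun_prop), lintegral_add_right _ measurable_const,
          setLIntegral_const, volume_gridCell]
    _ ≤ 2 ^ p * (c * cellVol d K + 2 ^ d * c * cellVol d K) := by
        gcongr
        obtain ⟨x, hx⟩ := gridCell_nonempty s K m₀
        have := hc x hx K (stopLevel_lt s bad hbK x) le_rfl
        rwa [show gridIdx s K x = m₀ from hx] at this
    _ ≤ 2 ^ p * (2 ^ d * c * cellVol d K + 2 ^ d * c * cellVol d K) := by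
        gcongr
        exact le_mul_of_one_le_left zero_le (one_le_pow₀ one_le_two)
    _ = _ := by ring

lemma lintegral_czPiece_le (hc : StoppedBound s bad hbK m₀ f p c) (hf : Measurable f)
    (hp : 1 ≤ p) {k : ℤ} (hk : k ≤ K) (n : ℕ) {x : Euc d} (hx : x ∈ gridCell s K m₀)
    (hxk : stopLevel s bad hbK x < k) :
    ∫⁻ z in gridCell s k (gridIdx s k x), ‖czPiece s (stopLevel s bad hbK) f k n z‖ₑ ^ p ≤
      2 ^ p * (2 ^ (d + 1) * c) * cellVol d k := by
  have hQ := measurableSet_gridCell s k (gridIdx s k x)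
  have hsub : gridCell s k (gridIdx s k x) ⊆ gridCell s K m₀ := gridCell_subset s hk rfl hx
  calc _ ≤ ∫⁻ z in gridCell s k (gridIdx s k x), 2 ^ p * (‖f z‖ₑ ^ p + 2 ^ d * c) := by
        refine setLIntegral_mono' hQ fun z hz => ?_
        by_cases hn : n = 0
        · rw [czPiece, if_pos hn]
          refine (enorm_cellMean_stopLevel_rpow_le s bad hbK hc hf hp (hsub hz)).trans ?_
          refine le_add_self.trans (le_mul_of_one_le_left zero_le ?_)
          exact ENNReal.one_le_rpow one_le_two (by linarith)
        · exact (enorm_czPiece_rpow_le s bad hbK hc hf hp (hsub hz) k hn).trans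
            (indicator_le_self _ _ z)
    _ = 2 ^ p * ((∫⁻ z in gridCell s k (gridIdx s k x), ‖f z‖ₑ ^ p) + 2 ^ d * c * cellVol d k) := by
        rw [lintegral_const_mul _ (by fun_prop), lintegral_add_right _ measurable_const,
          setLIntegral_const, volume_gridCell]
    _ ≤ 2 ^ p * (c * cellVol d k + 2 ^ d * c * cellVol d k) := by
        gcongr
        exact hc x hx k hxk hk
    _ ≤ 2 ^ p * (2 ^ d * c * cellVol d k + 2 ^ d * c * cellVol d k) := by
        gcongr
        exact le_mul_of_one_le_left zero_le (one_le_pow₀ one_le_two)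
    _ = _ := by ring

/-- If the stopping level equals `k - n` at one point of a cell of that level, it does so on the
whole cell. Hence the piece is there either `f` minus its mean or identically zero. -/
lemma integral_czPiece_eq_zero {N : ℝ} (hf : Measurable f) (hN : ∀ z, ‖f z‖ ≤ N) (k : ℤ) {n : ℕ}
    (hn : n ≠ 0) (m : Fin d → ℤ) :
    ∫ z in gridCell s (k - n) m, czPiece s (stopLevel s bad hbK) f k n z = 0 := by
  have hP := measurableSet_gridCell s (k - n) m
  have hvt := cellVol_ne_top (d := d) (k - n)
  by_cases h : ∃ x ∈ gridCell s (k - n) m, stopLevel s bad hbK x = k - n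
  · obtain ⟨x, hx, hxk⟩ := h
    have e1 : ∀ z ∈ gridCell s (k - n) m, czPiece s (stopLevel s bad hbK) f k n z =
        f z - cellMean s f (k - n) x := by
      intro z hz
      have hzx : gridIdx s (k - n) x = gridIdx s (k - n) z := Eq.trans hx (Eq.symm hz)
      have h2 : stopLevel s bad hbK z = k - n := by
        rw [← hxk]
        exact stopLevel_eq_of_gridIdx_eq s bad hbK (by rw [hxk]; exact hzx)
      rw [czPiece, if_neg hn, if_pos h2, h2, cellMean_congr s f hzx]
    rw [setIntegral_congr_fun hP e1, integral_sub, setIntegral_const, cellMean,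
      show gridIdx s (k - n) x = m from hx, measureReal_def, volume_gridCell, Complex.real_smul,
      mul_inv_cancel_left₀, sub_self]
    · simp [ENNReal.toReal_eq_zero_iff, cellVol_ne_zero, hvt]
    · have : IsFiniteMeasure (volume.restrict (gridCell s (k - n) m)) :=
        ⟨by rw [Measure.restrict_apply_univ, volume_gridCell]; exact hvt.lt_top⟩
      exact Integrable.of_bound hf.aestronglyMeasurable N (ae_of_all _ hN)
    · have : IsFiniteMeasure (volume.restrict (gridCell s (k - n) m)) :=
        ⟨by rw [Measure.restrict_apply_univ, volume_gridCell]; exact hvt.lt_top⟩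
      exact integrable_const _
  · push Not at h
    rw [setIntegral_congr_fun hP (g := fun _ => 0), integral_zero]
    intro z hz
    simp only [czPiece]
    rw [if_neg hn, if_neg (h z hz)]

lemma hasShiftRep_czPiece (hd : 0 < d) {N : ℝ} (hf : Measurable f) (hN : ∀ z, ‖f z‖ ≤ N) (k : ℤ)
    (n : ℕ) (m : Fin d → ℤ) :
    HasShiftRep (gridCell s k m) (czPiece s (stopLevel s bad hbK) f k n)
      (d * (2 : ℝ) ^ (k - n)) (2 ^ d) := by
  have hm := measurable_czPiece s (measurable_stopLevel s bad hbK) hf k n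
  by_cases hn : n = 0
  · subst hn
    refine (hasShiftRep_gridCell hd s k m hm).mono ?_ (one_le_pow₀ one_le_two)
    simp only [Nat.cast_zero, sub_zero]
    exact le_mul_of_one_le_left (by positivity) (by exact_mod_cast hd)
  · exact hasShiftRep_of_integral_eq_zero s (by omega) m hm (norm_czPiece_le s _ hN k n)
      (integral_czPiece_eq_zero s bad hbK hf hN k hn)

end PieceBounds

/-! ### Summation over cells and levels -/

section Summation

variable {d : ℕ} (s : Fin d → ℝ)

lemma setLIntegral_eq_tsum_gridCell (k : ℤ) {A : Set (Euc d)} (hA : MeasurableSet A)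
    (F : Euc d → ℝ≥0∞) : ∫⁻ x in A, F x = ∑' m, ∫⁻ x in A ∩ gridCell s k m, F x := by
  rw [← lintegral_iUnion, ← inter_iUnion, iUnion_gridCell, inter_univ]
  · exact fun m => hA.inter (measurableSet_gridCell s k m)
  · exact fun m m' h => (disjoint_gridCell s h).mono inter_subset_right inter_subset_right

/-- One factor `I` is kept and the remaining power `I ^ (r / p - 1)`, nonnegative because `p ≤ r`,
is bounded by the averages; the powers of `v` then cancel. What is left is linear in `I` and can be
summed over cells and levels. -/
lemma rpow_mul_rpow_mul_rpow_le {v I J G₁ G₂ : ℝ≥0∞} (hv0 : v ≠ 0) (hvt : v ≠ ∞) {p q r : ℝ}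
    (hp : 0 < p) (hq : 0 < q) (hpr : p ≤ r) (hI : I ≤ G₁ * v) (hJ : J ≤ G₂ * v) :
    v ^ (1 - r / p - r / q) * I ^ (r / p) * J ^ (r / q) ≤
      G₁ ^ (r / p - 1) * G₂ ^ (r / q) * I := by
  have h1 : 0 ≤ r / p - 1 := by rw [sub_nonneg, one_le_div hp]; exact hpr
  have h2 : 0 ≤ r / q := div_nonneg (by linarith) hq.le
  calc v ^ (1 - r / p - r / q) * I ^ (r / p) * J ^ (r / q)
      = v ^ (1 - r / p - r / q) * (I ^ (r / p - 1) * I) * J ^ (r / q) := by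
        congr 2
        conv_rhs => rw [← ENNReal.rpow_one I, ← ENNReal.rpow_mul, one_mul]
        rw [← ENNReal.rpow_add_of_nonneg _ _ h1 zero_le_one, sub_add_cancel]
    _ ≤ v ^ (1 - r / p - r / q) * ((G₁ * v) ^ (r / p - 1) * I) * (G₂ * v) ^ (r / q) := by
        gcongr
    _ = (v ^ (1 - r / p - r / q) * v ^ (r / p - 1) * v ^ (r / q)) *
          (G₁ ^ (r / p - 1) * G₂ ^ (r / q) * I) := by
        rw [ENNReal.mul_rpow_of_nonneg _ _ h1, ENNReal.mul_rpow_of_nonneg _ _ h2]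
        ring
    _ = _ := by
        rw [← ENNReal.rpow_add _ _ hv0 hvt, ← ENNReal.rpow_add _ _ hv0 hvt,
          show 1 - r / p - r / q + (r / p - 1) + r / q = 0 by ring, ENNReal.rpow_zero, one_mul]

lemma sum_levels_le {p q r : ℝ} (hp : 0 < p) (hq : 0 < q) (hpr : p ≤ r) (S : Finset ℤ)
    {E : ℤ → Set (Euc d)} (hE : ∀ k, MeasurableSet (E k))
    (hEc : ∀ k, ∀ x ∈ E k, gridCell s k (gridIdx s k x) ⊆ E k)
    (F φ ψ : ℤ → Euc d → ℝ≥0∞) {D G₁ G₂ V : ℝ≥0∞}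
    (hF : ∀ k ∈ S, ∀ x ∈ E k, ∫⁻ z in gridCell s k (gridIdx s k x), F k z ≤
      D * (cellVol d k ^ (1 - r / p - r / q) *
        (∫⁻ z in gridCell s k (gridIdx s k x), φ k z) ^ (r / p) *
        (∫⁻ z in gridCell s k (gridIdx s k x), ψ k z) ^ (r / q)))
    (hφ : ∀ k ∈ S, ∀ x ∈ E k, ∫⁻ z in gridCell s k (gridIdx s k x), φ k z ≤ G₁ * cellVol d k)
    (hψ : ∀ k ∈ S, ∀ x ∈ E k, ∫⁻ z in gridCell s k (gridIdx s k x), ψ k z ≤ G₂ * cellVol d k)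
    (hV : ∑ k ∈ S, ∫⁻ z in E k, φ k z ≤ G₁ * V) (hφm : ∀ k, Measurable (φ k)) :
    ∑ k ∈ S, ∫⁻ z in E k, F k z ≤ D * G₁ ^ (r / p) * G₂ ^ (r / q) * V := by
  have h1 : 0 ≤ r / p - 1 := by rw [sub_nonneg, one_le_div hp]; exact hpr
  have key : ∀ k ∈ S, ∫⁻ z in E k, F k z ≤
      D * (G₁ ^ (r / p - 1) * G₂ ^ (r / q)) * ∫⁻ z in E k, φ k z := by
    intro k hk
    rw [← lintegral_const_mul _ (hφm k), setLIntegral_eq_tsum_gridCell s k (hE k),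
      setLIntegral_eq_tsum_gridCell s k (hE k)]
    refine ENNReal.tsum_le_tsum fun m => ?_
    rcases (E k ∩ gridCell s k m).eq_empty_or_nonempty with h | ⟨x, hx, hxm⟩
    · simp [h]
    · have hm : gridIdx s k x = m := hxm
      rw [← hm, inter_eq_self_of_subset_right (hEc k x hx), lintegral_const_mul _ (hφm k)]
      refine (hF k hk x hx).trans ?_
      rw [mul_assoc D (_ * _)]
      gcongr D * ?_
      exact rpow_mul_rpow_mul_rpow_le (cellVol_ne_zero k) (cellVol_ne_top k) hp hq hpr
        (hφ k hk x hx) (hψ k hk x hx)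
  refine (Finset.sum_le_sum key).trans ?_
  rw [← Finset.mul_sum]
  calc _ ≤ D * (G₁ ^ (r / p - 1) * G₂ ^ (r / q)) * (G₁ * V) := by gcongr
    _ = D * (G₁ ^ (r / p - 1) * G₁ ^ (1 : ℝ)) * G₂ ^ (r / q) * V := by rw [ENNReal.rpow_one]; ring
    _ = _ := by rw [← ENNReal.rpow_add_of_nonneg _ _ h1 zero_le_one, sub_add_cancel]

end Summation

/-! ### The local estimate on a top cell -/

/-- The points in the middle third of their cell of level `k`. -/
def midCell {d : ℕ} (s : Fin d → ℝ) (k : ℤ) : Set (Euc d) :=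
  {x | ∀ i, Int.fract ((x i - s i) / (2 : ℝ) ^ k) ∈ Ico (1 / 3 : ℝ) (2 / 3)}

/-- The points of the top cell whose cell of level `k` is not contained in a stopping cell. -/
def activeSet {d : ℕ} (s : Fin d → ℝ) (bad : ℤ → (Fin d → ℤ) → Prop) {b K : ℤ} (hbK : b < K)
    (m₀ : Fin d → ℤ) (k : ℤ) : Set (Euc d) :=
  gridCell s K m₀ ∩ {x | stopLevel s bad hbK x < k}

section MidCell

variable {d : ℕ} (s : Fin d → ℝ)

lemma measurableSet_midCell (k : ℤ) : MeasurableSet (midCell s k) := by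
  have : midCell s k = ⋂ i, {x : Euc d | Int.fract ((x i - s i) / (2 : ℝ) ^ k) ∈
      Ico (1 / 3 : ℝ) (2 / 3)} := by
    ext; simp [midCell]
  rw [this]
  exact MeasurableSet.iInter fun i =>
    (by fun_prop : Measurable fun x : Euc d => Int.fract ((x i - s i) / (2 : ℝ) ^ k))
      measurableSet_Ico

/-- A displacement of at most a third of the side cannot leave the cell; the half-open middle third
keeps the upper bound strict. -/
lemma gridIdx_sub_eq_of_mem_midCell {k : ℤ} {x v : Euc d} (hx : x ∈ midCell s k)
    (hv : 3 * ‖v‖ ≤ (2 : ℝ) ^ k) : gridIdx s k (x - v) = gridIdx s k x := by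
  have h2 : (0 : ℝ) < (2 : ℝ) ^ k := by positivity
  funext i
  have h1 := hx i
  have h3 : |v i / (2 : ℝ) ^ k| ≤ 1 / 3 := by
    rw [abs_div, abs_of_pos h2, div_le_iff₀ h2]
    have := PiLp.norm_apply_le v i
    rw [Real.norm_eq_abs] at this
    linarith
  rw [abs_le] at h3
  have h4 := Int.self_sub_fract ((x i - s i) / (2 : ℝ) ^ k)
  simp only [gridIdx, PiLp.sub_apply]
  rw [Int.floor_eq_iff, ← h4, show (x i - v i - s i) / (2 : ℝ) ^ k =
    (x i - s i) / (2 : ℝ) ^ k - v i / (2 : ℝ) ^ k by ring]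
  constructor <;> linarith [h1.1, h1.2]

lemma ae_sub_smul_mem_gridCell {μ : Measure (Euc d × Euc d)} {n₀ : ℕ}
    (hμ : ∀ᵐ w ∂μ, 3 * ‖w.1‖ ≤ 2 ^ n₀ ∧ 3 * ‖w.2‖ ≤ 2 ^ n₀) {k : ℤ} {x : Euc d}
    (hx : x ∈ midCell s k) : ∀ᵐ w ∂μ,
      x - (2 : ℝ) ^ (k - n₀) • w.1 ∈ gridCell s k (gridIdx s k x) ∧
      x - (2 : ℝ) ^ (k - n₀) • w.2 ∈ gridCell s k (gridIdx s k x) := by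
  filter_upwards [hμ] with w hw
  have h2 : (0 : ℝ) < (2 : ℝ) ^ (k - n₀) := by positivity
  have key : ∀ v : Euc d, 3 * ‖v‖ ≤ 2 ^ n₀ → 3 * ‖(2 : ℝ) ^ (k - n₀) • v‖ ≤ (2 : ℝ) ^ k := by
    intro v hv
    rw [norm_smul, Real.norm_of_nonneg h2.le]
    calc 3 * ((2 : ℝ) ^ (k - n₀) * ‖v‖) = (2 : ℝ) ^ (k - n₀) * (3 * ‖v‖) := by ring
      _ ≤ (2 : ℝ) ^ (k - n₀) * 2 ^ n₀ := by gcongr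
      _ = (2 : ℝ) ^ k := by
        rw [← zpow_natCast, ← zpow_add₀ two_ne_zero, sub_add_cancel]
  exact ⟨gridIdx_sub_eq_of_mem_midCell s hx (key _ hw.1),
    gridIdx_sub_eq_of_mem_midCell s hx (key _ hw.2)⟩

end MidCell

section LocalEstimate

variable {d : ℕ} (μ : Measure (Euc d × Euc d)) [IsFiniteMeasure μ]

lemma measurable_bilinConv {f g : Euc d → ℂ} (hf : Measurable f) (hg : Measurable g) (t : ℝ) :
    Measurable (bilinConv μ t f g) := by
  have h : Measurable (Function.uncurry fun (x : Euc d) (w : Euc d × Euc d) =>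
      f (x - t • w.1) * g (x - t • w.2)) := by
    refine Measurable.mul (hf.comp ?_) (hg.comp ?_) <;> fun_prop
  exact (h.stronglyMeasurable.integral_prod_right (ν := μ)).measurable

/-- The bilinear convolution, restricted to the middle third of a cell of level `k`, is bounded with
geometric decay on functions represented by differences of translates by `O(2 ^ (k - n))` and
`O(2 ^ (k - n'))`. -/
def LocalBound (p q r : ℝ) (n₀ : ℕ) (D θ₁ θ₂ : ℝ≥0∞) : Prop :=
  ∀ (s : Fin d → ℝ) (k : ℤ) (n n' : ℕ) (m : Fin d → ℤ) (U V : Euc d → ℂ) (N : ℝ),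
    (∀ z, ‖U z‖ ≤ N) → (∀ z, ‖V z‖ ≤ N) →
    HasShiftRep (gridCell s k m) U (d * (2 : ℝ) ^ (k - n)) (2 ^ d) →
    HasShiftRep (gridCell s k m) V (d * (2 : ℝ) ^ (k - n')) (2 ^ d) →
    ∫⁻ x in gridCell s k m, (midCell s k).indicator
      (fun x => ‖bilinConv μ ((2 : ℝ) ^ (k - n₀)) U V x‖ₑ ^ r) x ≤
    (D * θ₁ ^ n * θ₂ ^ n') ^ r * (cellVol d k ^ (1 - r / p - r / q) *
      (∫⁻ z in gridCell s k m, ‖U z‖ₑ ^ p) ^ (r / p) *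
      (∫⁻ z in gridCell s k m, ‖V z‖ₑ ^ q) ^ (r / q))

/-- With `t = 2 ^ (k - n₀)`, a shift of size `d 2 ^ (k - n)` is `d 2 ^ n₀ 2 ^ (-n)` in units of `t`,
so the continuity estimate decays like `2 ^ (-η₁ n)`. The factor `t ^ (d (1/r - 1/p - 1/q))`, raised
to the power `r`, is the power of the cell volume up to a constant. -/
lemma exists_localBound (hd : 0 < d) {p q r : ℝ} (hp : 0 < p) (hq : 0 < q) (hr : 1 < r)
    (hcont : ContinuityEstimate μ p q r) {n₀ : ℕ}
    (hμ : ∀ᵐ w ∂μ, 3 * ‖w.1‖ ≤ 2 ^ n₀ ∧ 3 * ‖w.2‖ ≤ 2 ^ n₀) :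
    ∃ D θ₁ θ₂ : ℝ≥0∞, D ≠ ∞ ∧ θ₁ < 1 ∧ θ₂ < 1 ∧ LocalBound μ p q r n₀ D θ₁ θ₂ := by
  obtain ⟨η₁, η₂, hη₁, hη₂, C, hC, hest⟩ := hcont
  have hd' : (0 : ℝ) < d := by exact_mod_cast hd
  have hr0 : 0 < r := by linarith
  have hθ : ∀ η : ℝ, 0 < η → ENNReal.ofReal ((1 / 2 : ℝ) ^ η) < 1 := fun η hη => by
    rw [ENNReal.ofReal_lt_one]
    exact Real.rpow_lt_one (by norm_num) (by norm_num) hη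
  set e : ℝ := (d : ℝ) * (1 / r - 1 / p - 1 / q) with he
  set a : ℝ := d * 2 ^ n₀ with ha
  -- The two factors `2 ^ d` are the masses of the shift representations; the powers of `2 ^ n₀` and
  -- `a` come from measuring scale and shifts against `2 ^ k` instead of `t`.
  refine ⟨2 ^ d * 2 ^ d * ENNReal.ofReal (C * ((2 : ℝ) ^ n₀) ^ (-e) * a ^ η₁ * a ^ η₂),
    ENNReal.ofReal ((1 / 2 : ℝ) ^ η₁), ENNReal.ofReal ((1 / 2 : ℝ) ^ η₂),
    ENNReal.mul_ne_top (by finiteness) (by finiteness), hθ _ hη₁, hθ _ hη₂, ?_⟩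
  intro s k n n' m U V N hU hV hUr hVr
  set t : ℝ := (2 : ℝ) ^ (k - n₀) with ht
  have ht0 : 0 < t := by positivity
  let κ : ℝ → ℝ → ℝ := fun x y => C * t ^ e * (x / t) ^ η₁ * (y / t) ^ η₂
  have hQ := measurableSet_gridCell s k m
  have hM := measurableSet_midCell s k
  have h1 := lintegral_bilinConv_rpow_le_of_shiftRep μ hp hq hr (t := t) (κ := κ)
    (Q := gridCell s k m) (A := gridCell s k m ∩ midCell s k) (U := U) (V := V) (N := N)
    (W₁ := 2 ^ d) (W₂ := 2 ^ d) ?_ ?_ hQ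
    (by rw [volume_gridCell]; exact cellVol_ne_top k) ?_ hU hV (by finiteness) (by finiteness)
    hUr hVr (hQ.inter hM)
  · rw [setLIntegral_indicator hM, inter_comm]
    refine h1.trans (le_of_eq ?_)
    have hscale : ∀ (η : ℝ) (n : ℕ), (d * (2 : ℝ) ^ (k - n) / t) ^ η =
        a ^ η * ((1 / 2 : ℝ) ^ η) ^ n := by
      intro η n
      have : d * (2 : ℝ) ^ (k - n) / t = a * (1 / 2 : ℝ) ^ n := by
        rw [ha, ht, zpow_sub₀ two_ne_zero, zpow_sub₀ two_ne_zero, zpow_natCast, zpow_natCast,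
          one_div, inv_pow]
        field_simp
      rw [this, Real.mul_rpow (by positivity) (by positivity), ← Real.rpow_natCast,
        ← Real.rpow_natCast, ← Real.rpow_mul (by norm_num), ← Real.rpow_mul (by norm_num),
        mul_comm η]
    have hte : t ^ e = ((2 : ℝ) ^ n₀) ^ (-e) * ((2 : ℝ) ^ k) ^ e := by
      rw [ht, zpow_sub₀ two_ne_zero, zpow_natCast, Real.div_rpow (by positivity) (by positivity),
        Real.rpow_neg (by positivity)]
      field_simp
    have hvol : cellVol d k ^ (1 - r / p - r / q) = ENNReal.ofReal (((2 : ℝ) ^ k) ^ e) ^ r := by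
      rw [← ENNReal.ofReal_rpow_of_pos (by positivity), cellVol, ← ENNReal.rpow_natCast,
        ← ENNReal.rpow_mul, ← ENNReal.rpow_mul, he]
      congr 1
      field_simp
    have hκ : ENNReal.ofReal (κ (d * (2 : ℝ) ^ (k - n)) (d * (2 : ℝ) ^ (k - n'))) =
        ENNReal.ofReal (C * ((2 : ℝ) ^ n₀) ^ (-e) * a ^ η₁ * a ^ η₂) *
          ENNReal.ofReal ((1 / 2 : ℝ) ^ η₁) ^ n * ENNReal.ofReal ((1 / 2 : ℝ) ^ η₂) ^ n' *
          ENNReal.ofReal (((2 : ℝ) ^ k) ^ e) := by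
      rw [← ENNReal.ofReal_pow (by positivity), ← ENNReal.ofReal_pow (by positivity),
        ← ENNReal.ofReal_mul (by positivity), ← ENNReal.ofReal_mul (by positivity),
        ← ENNReal.ofReal_mul (by positivity)]
      congr 1
      simp only [κ]
      rw [hscale, hscale, hte]
      ring
    rw [hκ, hvol, ← mul_assoc, ENNReal.mul_rpow_of_nonneg _ (ENNReal.ofReal _) hr0.le]
    simp only [mul_assoc]
  · intro x y x' y' hx hxx hy hyy
    have := hx.trans hxx
    simp only [κ]
    gcongr
  · intro y₁ y₂ f g hf hg
    exact hest t ht0 y₁ y₂ f g hf hg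
  · intro x hx
    have := ae_sub_smul_mem_gridCell s hμ hx.2
    rwa [show gridIdx s k x = m from hx.1] at this

section Active

variable (s : Fin d → ℝ) (bad : ℤ → (Fin d → ℤ) → Prop) {b K : ℤ} (hbK : b < K) (m₀ : Fin d → ℤ)

lemma measurableSet_activeSet (k : ℤ) : MeasurableSet (activeSet s bad hbK m₀ k) :=
  (measurableSet_gridCell s K m₀).inter (measurable_stopLevel s bad hbK measurableSet_Iio)

lemma gridCell_subset_activeSet {k : ℤ} (hk : k ≤ K) {x : Euc d}
    (hx : x ∈ activeSet s bad hbK m₀ k) :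
    gridCell s k (gridIdx s k x) ⊆ activeSet s bad hbK m₀ k := fun _ hy =>
  ⟨gridCell_subset s hk rfl hx.1 hy, stopLevel_lt_of_gridIdx_eq s bad hbK (Eq.symm hy) hx.2⟩

end Active

end LocalEstimate

section TopCell

variable {d : ℕ} (μ : Measure (Euc d × Euc d)) (s : Fin d → ℝ)
  (bad : ℤ → (Fin d → ℤ) → Prop) {b K : ℤ} (hbK : b < K) {m₀ : Fin d → ℤ} {f g : Euc d → ℂ}
  {p q r : ℝ} {c₁ c₂ : ℝ≥0∞} {N : ℝ} {n₀ : ℕ}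

lemma integrable_bilinConv [IsFiniteMeasure μ] {U V : Euc d → ℂ} (hU : Measurable U)
    (hV : Measurable V)
    {N₁ N₂ : ℝ} (hUN : ∀ z, ‖U z‖ ≤ N₁) (hVN : ∀ z, ‖V z‖ ≤ N₂) (t : ℝ) (x : Euc d) :
    Integrable (fun w : Euc d × Euc d => U (x - t • w.1) * V (x - t • w.2)) μ := by
  refine Integrable.of_bound (C := N₁ * N₂) ?_ (ae_of_all _ fun w => ?_)
  · refine Measurable.aestronglyMeasurable ?_
    refine Measurable.mul (hU.comp ?_) (hV.comp ?_) <;> fun_prop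
  · rw [norm_mul]
    gcongr
    · exact (norm_nonneg _).trans (hUN 0)
    · exact hUN _
    · exact hVN _

/-- On an active cell every point has its stopping level in `[b, k)`, so the offsets below `M`
recover `f` and `g` there, and nothing outside the cell is seen. -/
lemma bilinConv_eq_sum_czPiece [IsFiniteMeasure μ] (hf : Measurable f) (hg : Measurable g)
    (hfN : ∀ z, ‖f z‖ ≤ N)
    (hgN : ∀ z, ‖g z‖ ≤ N) (hμ : ∀ᵐ w ∂μ, 3 * ‖w.1‖ ≤ 2 ^ n₀ ∧ 3 * ‖w.2‖ ≤ 2 ^ n₀) {k : ℤ}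
    (hk : k ≤ K) {M : ℕ} (hM : K - b < M) {x : Euc d} (hx : x ∈ activeSet s bad hbK m₀ k)
    (hxm : x ∈ midCell s k) :
    bilinConv μ ((2 : ℝ) ^ (k - n₀)) f g x =
      ∑ n ∈ Finset.range M, ∑ n' ∈ Finset.range M, bilinConv μ ((2 : ℝ) ^ (k - n₀))
        (czPiece s (stopLevel s bad hbK) f k n) (czPiece s (stopLevel s bad hbK) g k n') x := by
  have hσ := measurable_stopLevel s bad hbK
  have hint : ∀ n n' : ℕ, Integrable (fun w : Euc d × Euc d =>
      czPiece s (stopLevel s bad hbK) f k n (x - (2 : ℝ) ^ (k - n₀) • w.1) *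
      czPiece s (stopLevel s bad hbK) g k n' (x - (2 : ℝ) ^ (k - n₀) • w.2)) μ := fun n n' =>
    integrable_bilinConv μ (measurable_czPiece s hσ hf k n) (measurable_czPiece s hσ hg k n')
      (norm_czPiece_le s _ hfN k n) (norm_czPiece_le s _ hgN k n') _ x
  simp only [bilinConv]
  simp_rw [← integral_finsetSum _ (fun n' _ => hint _ n')]
  rw [← integral_finsetSum _ (fun n _ => integrable_finsetSum _ fun n' _ => hint n n')]
  refine integral_congr_ae ?_
  filter_upwards [ae_sub_smul_mem_gridCell s hμ hxm] with w hw
  have key : ∀ (f : Euc d → ℂ) (z : Euc d), z ∈ gridCell s k (gridIdx s k x) →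
      f z = ∑ n ∈ Finset.range M, czPiece s (stopLevel s bad hbK) f k n z := by
    intro f z hz
    have h1 := stopLevel_lt_of_gridIdx_eq s bad hbK (Eq.symm hz) hx.2
    have h2 := le_stopLevel s bad hbK z
    exact (sum_czPiece s f h1 (by omega)).symm
  rw [key f _ hw.1, key g _ hw.2, Finset.sum_mul_sum]

lemma sum_lintegral_bilinConv_czPiece_le (hd : 0 < d) {D θ₁ θ₂ : ℝ≥0∞}
    (hloc : LocalBound μ p q r n₀ D θ₁ θ₂) (hp : 1 ≤ p) (hq : 1 ≤ q) (hpr : p ≤ r) (hqr : q ≤ r)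
    (hf : Measurable f) (hg : Measurable g) (hfN : ∀ z, ‖f z‖ ≤ N) (hgN : ∀ z, ‖g z‖ ≤ N)
    (hc₁ : StoppedBound s bad hbK m₀ f p c₁) (hc₂ : StoppedBound s bad hbK m₀ g q c₂) {n n' : ℕ}
    (hn : n ≠ 0 ∨ n' ≠ 0) :
    ∑ k ∈ Finset.Ioc b K, ∫⁻ x in activeSet s bad hbK m₀ k, (midCell s k).indicator
      (fun x => ‖bilinConv μ ((2 : ℝ) ^ (k - n₀)) (czPiece s (stopLevel s bad hbK) f k n)
        (czPiece s (stopLevel s bad hbK) g k n') x‖ₑ ^ r) x ≤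
    (D * θ₁ ^ n * θ₂ ^ n') ^ r * (2 ^ p * (2 ^ (d + 1) * c₁)) ^ (r / p) *
      (2 ^ q * (2 ^ (d + 1) * c₂)) ^ (r / q) * cellVol d K := by
  have hp0 : 0 < p := by linarith
  have hq0 : 0 < q := by linarith
  have hσ := measurable_stopLevel s bad hbK
  have hE := measurableSet_activeSet s bad hbK m₀
  have hm₁ := fun k => ((measurable_czPiece s hσ hf k n).enorm).pow_const p
  have hm₂ := fun k => ((measurable_czPiece s hσ hg k n').enorm).pow_const q
  set φ : ℤ → Euc d → ℝ≥0∞ := fun k z => ‖czPiece s (stopLevel s bad hbK) f k n z‖ₑ ^ p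
  set ψ : ℤ → Euc d → ℝ≥0∞ := fun k z => ‖czPiece s (stopLevel s bad hbK) g k n' z‖ₑ ^ q
  set F : ℤ → Euc d → ℝ≥0∞ := fun k x => (midCell s k).indicator
      (fun x => ‖bilinConv μ ((2 : ℝ) ^ (k - n₀)) (czPiece s (stopLevel s bad hbK) f k n)
        (czPiece s (stopLevel s bad hbK) g k n') x‖ₑ ^ r) x
  -- Active sets are unions of cells of level `k` only for `k ≤ K`; the empty set is a harmless
  -- value at the other levels.
  let E : ℤ → Set (Euc d) := fun k => if k ≤ K then activeSet s bad hbK m₀ k else ∅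
  have hEk : ∀ {k}, k ∈ Finset.Ioc b K → E k = activeSet s bad hbK m₀ k := fun hk =>
    if_pos (Finset.mem_Ioc.1 hk).2
  have hEm : ∀ k, MeasurableSet (E k) := by
    intro k
    by_cases hk : k ≤ K <;> simp [E, hk, hE]
  have hEc : ∀ k, ∀ x ∈ E k, gridCell s k (gridIdx s k x) ⊆ E k := by
    intro k x hx
    by_cases hk : k ≤ K
    · simp only [E, if_pos hk] at hx ⊢
      exact gridCell_subset_activeSet s bad hbK m₀ hk hx
    · simp [E, hk] at hx
  have hF : ∀ k ∈ Finset.Ioc b K, ∀ x ∈ E k, ∫⁻ z in gridCell s k (gridIdx s k x), F k z ≤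
      (D * θ₁ ^ n * θ₂ ^ n') ^ r * (cellVol d k ^ (1 - r / p - r / q) *
        (∫⁻ z in gridCell s k (gridIdx s k x), φ k z) ^ (r / p) *
        (∫⁻ z in gridCell s k (gridIdx s k x), ψ k z) ^ (r / q)) := fun k _ x _ =>
    hloc s k n n' _ _ _ (N + N) (norm_czPiece_le s _ hfN k n) (norm_czPiece_le s _ hgN k n')
      (hasShiftRep_czPiece s bad hbK hd hf hfN k n _)
      (hasShiftRep_czPiece s bad hbK hd hg hgN k n' _)
  have hφ : ∀ k ∈ Finset.Ioc b K, ∀ x ∈ E k, ∫⁻ z in gridCell s k (gridIdx s k x), φ k z ≤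
      2 ^ p * (2 ^ (d + 1) * c₁) * cellVol d k := by
    intro k hk x hx
    rw [hEk hk] at hx
    exact lintegral_czPiece_le s bad hbK hc₁ hf hp (Finset.mem_Ioc.1 hk).2 n hx.1 hx.2
  have hψ : ∀ k ∈ Finset.Ioc b K, ∀ x ∈ E k, ∫⁻ z in gridCell s k (gridIdx s k x), ψ k z ≤
      2 ^ q * (2 ^ (d + 1) * c₂) * cellVol d k := by
    intro k hk x hx
    rw [hEk hk] at hx
    exact lintegral_czPiece_le s bad hbK hc₂ hg hq (Finset.mem_Ioc.1 hk).2 n' hx.1 hx.2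
  have hEF : ∑ k ∈ Finset.Ioc b K, ∫⁻ x in activeSet s bad hbK m₀ k, F k x =
      ∑ k ∈ Finset.Ioc b K, ∫⁻ x in E k, F k x :=
    Finset.sum_congr rfl fun k hk => by rw [hEk hk]
  rw [hEF]
  rcases hn with hn | hn
  · refine sum_levels_le s hp0 hq0 hpr _ hEm hEc F φ ψ hF hφ hψ ?_ hm₁
    refine le_trans ?_ (sum_lintegral_czPiece_le s bad hbK hc₁ hf hp hn)
    refine Finset.sum_le_sum fun k hk => lintegral_mono_set ?_
    rw [hEk hk]
    exact inter_subset_left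
  -- When the disjointness comes from `g`, the roles of `f` and `g` are exchanged, using `q ≤ r`.
  · refine (sum_levels_le (D := (D * θ₁ ^ n * θ₂ ^ n') ^ r) (V := cellVol d K)
      s hq0 hp0 hqr _ hEm hEc F ψ φ ?_ hψ hφ ?_ hm₂).trans ?_
    · intro k hk x hx
      convert hF k hk x hx using 1
      rw [sub_right_comm]
      ring
    · refine le_trans ?_ (sum_lintegral_czPiece_le s bad hbK hc₂ hg hq hn)
      refine Finset.sum_le_sum fun k hk => lintegral_mono_set ?_
      rw [hEk hk]
      exact inter_subset_left
    · rw [mul_right_comm ((D * θ₁ ^ n * θ₂ ^ n') ^ r)]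

lemma enorm_bilinConv_czPiece_zero_le (hp : 1 ≤ p) (hq : 1 ≤ q)
    (hf : Measurable f) (hg : Measurable g)
    (hμ : ∀ᵐ w ∂μ, 3 * ‖w.1‖ ≤ 2 ^ n₀ ∧ 3 * ‖w.2‖ ≤ 2 ^ n₀)
    (hc₁ : StoppedBound s bad hbK m₀ f p c₁) (hc₂ : StoppedBound s bad hbK m₀ g q c₂)
    {k : ℤ} (hk : k ≤ K) {x : Euc d} (hx : x ∈ gridCell s K m₀) (hxm : x ∈ midCell s k) :
    ‖bilinConv μ ((2 : ℝ) ^ (k - n₀)) (czPiece s (stopLevel s bad hbK) f k 0)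
        (czPiece s (stopLevel s bad hbK) g k 0) x‖ₑ ≤
      μ univ * (2 ^ p * (2 ^ (d + 1) * c₁)) ^ (1 / p) * (2 ^ q * (2 ^ (d + 1) * c₂)) ^ (1 / q) := by
  have key : ∀ {f : Euc d → ℂ} {p : ℝ} {c : ℝ≥0∞}, 1 ≤ p → Measurable f →
      StoppedBound s bad hbK m₀ f p c → ∀ z ∈ gridCell s k (gridIdx s k x),
      ‖czPiece s (stopLevel s bad hbK) f k 0 z‖ₑ ≤ (2 ^ p * (2 ^ (d + 1) * c)) ^ (1 / p) := by
    intro f p c hp hf hc z hz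
    have hp0 : 0 < p := by linarith
    have h1 := enorm_cellMean_stopLevel_rpow_le s bad hbK hc hf hp (gridCell_subset s hk rfl hx hz)
    rw [czPiece, if_pos rfl, one_div, ENNReal.le_rpow_inv_iff hp0]
    refine h1.trans ?_
    rw [pow_succ, mul_assoc ((2 : ℝ≥0∞) ^ d), mul_left_comm]
    gcongr
    rw [← mul_assoc]
    exact le_mul_of_one_le_left zero_le
      (one_le_mul (ENNReal.one_le_rpow one_le_two (by linarith)) one_le_two)
  refine (enorm_integral_le_lintegral_enorm _).trans ?_
  calc _ ≤ ∫⁻ _, (2 ^ p * (2 ^ (d + 1) * c₁)) ^ (1 / p) *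
          (2 ^ q * (2 ^ (d + 1) * c₂)) ^ (1 / q) ∂μ := by
        refine lintegral_mono_ae ?_
        filter_upwards [ae_sub_smul_mem_gridCell s hμ hxm] with w hw
        rw [enorm_mul]
        gcongr
        · exact key hp hf hc₁ _ hw.1
        · exact key hq hg hc₂ _ hw.2
    _ = _ := by rw [lintegral_const]; ring

/-- The levels above the stopping cells cost one term of the sparse form. The constant `D + μ univ`
serves both the terms with decay and the good-good term, and the geometric series remove any
dependence on the number of levels. -/
lemma lintegral_iSup_activeSet_le [IsFiniteMeasure μ] (hd : 0 < d) {D θ₁ θ₂ : ℝ≥0∞}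
    (hloc : LocalBound μ p q r n₀ D θ₁ θ₂) (hr : 1 < r)
    (hp : 1 ≤ p) (hq : 1 ≤ q) (hpr : p ≤ r) (hqr : q ≤ r)
    (hf : Measurable f) (hg : Measurable g) (hfN : ∀ z, ‖f z‖ ≤ N) (hgN : ∀ z, ‖g z‖ ≤ N)
    (hμ : ∀ᵐ w ∂μ, 3 * ‖w.1‖ ≤ 2 ^ n₀ ∧ 3 * ‖w.2‖ ≤ 2 ^ n₀)
    (hc₁ : StoppedBound s bad hbK m₀ f p c₁) (hc₂ : StoppedBound s bad hbK m₀ g q c₂)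
    {h : Euc d → ℝ≥0∞} (hh : Measurable h) :
    ∫⁻ x in gridCell s K m₀, (⨆ k ∈ Finset.Ioc b K,
      (activeSet s bad hbK m₀ k ∩ midCell s k).indicator
        (fun x => ‖bilinConv μ ((2 : ℝ) ^ (k - n₀)) f g x‖ₑ) x) * h x ≤
    (D + μ univ) * (1 - θ₁)⁻¹ * (1 - θ₂)⁻¹ *
      ((2 ^ p * (2 ^ (d + 1) * c₁)) ^ (1 / p) * (2 ^ q * (2 ^ (d + 1) * c₂)) ^ (1 / q)) *
      (cellVol d K ^ (1 / r) *
        (∫⁻ x in gridCell s K m₀, h x ^ (r / (r - 1))) ^ (1 / (r / (r - 1)))) := by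
  have hr0 : 0 < r := by linarith
  have hσ := measurable_stopLevel s bad hbK
  have hQ := measurableSet_gridCell s K m₀
  set G₁ : ℝ≥0∞ := 2 ^ p * (2 ^ (d + 1) * c₁)
  set G₂ : ℝ≥0∞ := 2 ^ q * (2 ^ (d + 1) * c₂)
  let B : ℤ → Set (Euc d) := fun k => activeSet s bad hbK m₀ k ∩ midCell s k
  have hB : ∀ k, MeasurableSet (B k) := fun k =>
    (measurableSet_activeSet s bad hbK m₀ k).inter (measurableSet_midCell s k)
  let T : ℕ → ℕ → ℤ → Euc d → ℝ≥0∞ := fun n n' k x =>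
    ‖bilinConv μ ((2 : ℝ) ^ (k - n₀)) (czPiece s (stopLevel s bad hbK) f k n)
        (czPiece s (stopLevel s bad hbK) g k n') x‖ₑ
  have hT : ∀ n n' k, Measurable (T n n' k) := fun n n' k =>
    (measurable_bilinConv μ (measurable_czPiece s hσ hf k n)
      (measurable_czPiece s hσ hg k n') _).enorm
  let A : ℕ → ℕ → Euc d → ℝ≥0∞ := fun n n' x => ⨆ k ∈ Finset.Ioc b K, (B k).indicator (T n n' k) x
  have hA : ∀ n n', Measurable (A n n') := fun n n' =>
    Measurable.iSup fun k => Measurable.iSup fun _ => (hT n n' k).indicator (hB k)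
  obtain ⟨M, hM⟩ : ∃ M : ℕ, K - b < M := ⟨(K - b).toNat + 1, by omega⟩
  have hpt : ∀ x, (⨆ k ∈ Finset.Ioc b K, (B k).indicator
      (fun x => ‖bilinConv μ ((2 : ℝ) ^ (k - n₀)) f g x‖ₑ) x) ≤
      ∑ n ∈ Finset.range M, ∑ n' ∈ Finset.range M, A n n' x := by
    intro x
    refine iSup₂_le fun k hk => ?_
    by_cases hx : x ∈ B k
    · rw [indicator_of_mem hx, bilinConv_eq_sum_czPiece μ s bad hbK hf hg hfN hgN hμ
        (Finset.mem_Ioc.1 hk).2 hM hx.1 hx.2]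
      refine (enorm_sum_le _ _).trans (Finset.sum_le_sum fun n _ =>
        (enorm_sum_le _ _).trans (Finset.sum_le_sum fun n' _ => ?_))
      refine le_trans ?_ (le_iSup₂ (f := fun k _ => (B k).indicator (T n n' k) x) k hk)
      rw [indicator_of_mem hx]
    · rw [indicator_of_notMem hx]
      exact zero_le
  have hAr : ∀ n n', ∫⁻ x in gridCell s K m₀, A n n' x ^ r ≤
      ((D + μ univ) * θ₁ ^ n * θ₂ ^ n') ^ r * G₁ ^ (r / p) * G₂ ^ (r / q) * cellVol d K := by
    intro n n'
    by_cases hn : n ≠ 0 ∨ n' ≠ 0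
    · calc ∫⁻ x in gridCell s K m₀, A n n' x ^ r
          ≤ ∫⁻ x in gridCell s K m₀, ∑ k ∈ Finset.Ioc b K,
              (B k).indicator (fun x => T n n' k x ^ r) x := by
            gcongr with x
            have h1 : ∀ k ∈ Finset.Ioc b K, (B k).indicator (T n n' k) x ≤
                (∑ k ∈ Finset.Ioc b K, (B k).indicator (fun x => T n n' k x ^ r) x) ^ r⁻¹ := by
              intro k hk
              rw [ENNReal.le_rpow_inv_iff hr0]
              refine le_trans (le_of_eq ?_) (Finset.single_le_sum (f := fun k =>
                (B k).indicator (fun x => T n n' k x ^ r) x) (fun _ _ => zero_le) hk)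
              by_cases hx : x ∈ B k <;> simp [hx, hr0]
            exact (ENNReal.le_rpow_inv_iff hr0).1 (iSup₂_le h1)
        _ = ∑ k ∈ Finset.Ioc b K, ∫⁻ x in gridCell s K m₀,
              (B k).indicator (fun x => T n n' k x ^ r) x :=
            lintegral_finsetSum _ fun k _ => ((hT n n' k).pow_const r).indicator (hB k)
        _ ≤ ∑ k ∈ Finset.Ioc b K, ∫⁻ x in activeSet s bad hbK m₀ k,
              (midCell s k).indicator (fun x => T n n' k x ^ r) x := by
            refine Finset.sum_le_sum fun k _ => ?_
            refine (setLIntegral_le_lintegral _ _).trans (le_of_eq ?_)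
            rw [lintegral_indicator (hB k), setLIntegral_indicator (measurableSet_midCell s k),
              inter_comm]
        _ ≤ _ := sum_lintegral_bilinConv_czPiece_le μ s bad hbK hd hloc hp hq hpr hqr hf hg hfN
              hgN hc₁ hc₂ hn
        _ ≤ _ := by
            gcongr
            exact le_self_add
    -- For two good parts there is no disjointness in `k`, so the supremum is bounded pointwise.
    · push Not at hn
      obtain ⟨rfl, rfl⟩ := hn
      simp only [pow_zero, mul_one]
      calc ∫⁻ x in gridCell s K m₀, A 0 0 x ^ r
          ≤ ∫⁻ _ in gridCell s K m₀, (μ univ * G₁ ^ (1 / p) * G₂ ^ (1 / q)) ^ r := by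
            gcongr with x
            refine iSup₂_le fun k hk => ?_
            by_cases hx : x ∈ B k
            · rw [indicator_of_mem hx]
              exact enorm_bilinConv_czPiece_zero_le μ s bad hbK hp hq hf hg hμ hc₁ hc₂
                (Finset.mem_Ioc.1 hk).2 hx.1.1 hx.2
            · rw [indicator_of_notMem hx]
              exact zero_le
        _ = μ univ ^ r * G₁ ^ (r / p) * G₂ ^ (r / q) * cellVol d K := by
            rw [setLIntegral_const, volume_gridCell, ENNReal.mul_rpow_of_nonneg _ _ hr0.le,
              ENNReal.mul_rpow_of_nonneg _ _ hr0.le, ← ENNReal.rpow_mul, ← ENNReal.rpow_mul,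
              one_div_mul_eq_div, one_div_mul_eq_div]
        _ ≤ _ := by
            gcongr
            exact le_add_self
  have hHolder : ∀ n n', ∫⁻ x in gridCell s K m₀, A n n' x * h x ≤
      (D + μ univ) * θ₁ ^ n * θ₂ ^ n' * (G₁ ^ (1 / p) * G₂ ^ (1 / q)) * (cellVol d K ^ (1 / r) *
        (∫⁻ x in gridCell s K m₀, h x ^ (r / (r - 1))) ^ (1 / (r / (r - 1)))) := by
    intro n n'
    refine (ENNReal.lintegral_mul_le_Lp_mul_Lq _ (Real.HolderConjugate.conjExponent hr)
      (hA n n').aemeasurable hh.aemeasurable).trans ?_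
    rw [← mul_assoc]
    refine mul_le_mul' ?_ le_rfl
    refine (ENNReal.rpow_le_rpow (hAr n n') (by positivity)).trans (le_of_eq ?_)
    rw [ENNReal.mul_rpow_of_nonneg _ _ (by positivity),
      ENNReal.mul_rpow_of_nonneg _ _ (by positivity),
      ENNReal.mul_rpow_of_nonneg _ _ (by positivity), ← ENNReal.rpow_mul, ← ENNReal.rpow_mul,
      ← ENNReal.rpow_mul, mul_one_div_cancel hr0.ne', ENNReal.rpow_one, ← mul_assoc,
      show r / p * (1 / r) = 1 / p by field_simp, show r / q * (1 / r) = 1 / q by field_simp]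
  set H := (cellVol d K ^ (1 / r) *
        (∫⁻ x in gridCell s K m₀, h x ^ (r / (r - 1))) ^ (1 / (r / (r - 1))))
  set G := G₁ ^ (1 / p) * G₂ ^ (1 / q)
  calc _ ≤ ∫⁻ x in gridCell s K m₀,
          ∑ n ∈ Finset.range M, ∑ n' ∈ Finset.range M, A n n' x * h x := by
        gcongr with x
        refine (mul_le_mul' (hpt x) le_rfl).trans (le_of_eq ?_)
        simp_rw [Finset.sum_mul]
    _ = ∑ n ∈ Finset.range M, ∑ n' ∈ Finset.range M, ∫⁻ x in gridCell s K m₀, A n n' x * h x := by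
        have hAh : ∀ n n', Measurable fun x => A n n' x * h x := fun n n' => (hA n n').mul hh
        rw [lintegral_finsetSum _ fun n _ => Finset.measurable_fun_sum _ fun n' _ => hAh n n']
        exact Finset.sum_congr rfl fun n _ => lintegral_finsetSum _ fun n' _ => hAh n n'
    _ ≤ ∑ n ∈ Finset.range M, ∑ n' ∈ Finset.range M,
          (D + μ univ) * θ₁ ^ n * θ₂ ^ n' * G * H :=
        Finset.sum_le_sum fun n _ => Finset.sum_le_sum fun n' _ => hHolder n n'
    _ = (D + μ univ) * (∑ n ∈ Finset.range M, θ₁ ^ n) * (∑ n ∈ Finset.range M, θ₂ ^ n) * G * H := by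
        simp_rw [Finset.mul_sum, Finset.sum_mul]
        rw [Finset.sum_comm]
    _ ≤ _ := by
        gcongr
        · rw [← ENNReal.tsum_geometric]
          exact ENNReal.sum_le_tsum _
        · rw [← ENNReal.tsum_geometric]
          exact ENNReal.sum_le_tsum _

end TopCell

/-! ### Operations on sparse families -/

section Sparse

variable {d : ℕ}

lemma Cube.toSet_nonempty (Q : Cube d) : Q.toSet.Nonempty :=
  ⟨WithLp.toLp 2 Q.corner, fun _ => ⟨le_rfl, lt_add_of_pos_right _ Q.side_pos⟩⟩

lemma eq_of_mem_of_pairwise_disjoint {ι : Type*} {R : ι → Set (Euc d)}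
    (hR : Pairwise (Function.onFun Disjoint R)) {S : ι → Set (Cube d)}
    (hSR : ∀ i, ∀ Q ∈ S i, Q.toSet ⊆ R i) {i j : ι} {Q : Cube d} (hi : Q ∈ S i) (hj : Q ∈ S j) :
    i = j := by
  by_contra h
  obtain ⟨x, hx⟩ := Q.toSet_nonempty
  exact Set.disjoint_left.1 (hR h) (hSR i Q hi hx) (hSR j Q hj hx)

lemma IsSparse.iUnion {γ : ℝ} {ι : Type*} {R : ι → Set (Euc d)}
    (hR : Pairwise (Function.onFun Disjoint R)) {S : ι → Set (Cube d)}
    (hSR : ∀ i, ∀ Q ∈ S i, Q.toSet ⊆ R i) (hS : ∀ i, IsSparse γ (S i)) :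
    IsSparse γ (⋃ i, S i) := by
  classical
  choose F hF hFd using hS
  -- A cube is nonempty and the regions are disjoint, so it belongs to at most one family and the
  -- choice of index is harmless.
  let G : Cube d → Set (Euc d) := fun Q =>
    if h : ∃ i, Q ∈ S i then F h.choose Q else ∅
  have hG : ∀ i, ∀ Q ∈ S i, G Q = F i Q := by
    intro i Q hQ
    have h : ∃ i, Q ∈ S i := ⟨i, hQ⟩
    simp only [G, dif_pos h]
    rw [eq_of_mem_of_pairwise_disjoint hR hSR h.choose_spec hQ]
  refine ⟨G, ?_, ?_⟩
  · intro Q hQ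
    obtain ⟨i, hi⟩ := mem_iUnion.1 hQ
    rw [hG i Q hi]
    exact hF i Q hi
  · intro Q hQ Q' hQ' hne
    obtain ⟨i, hi⟩ := mem_iUnion.1 hQ
    obtain ⟨j, hj⟩ := mem_iUnion.1 hQ'
    rw [hG i Q hi, hG j Q' hj]
    by_cases hij : i = j
    · subst hij
      exact hFd i Q hi Q' hj hne
    · exact (hR hij).mono ((hF i Q hi).2.1.trans (hSR i Q hi))
        ((hF j Q' hj).2.1.trans (hSR j Q' hj))

lemma IsSparse.insert {γ : ℝ} {S : Set (Cube d)} (hS : IsSparse γ S) {R : Set (Euc d)}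
    (hSR : ∀ Q ∈ S, Q.toSet ⊆ R) {Q₀ : Cube d} (hm : MeasurableSet (Q₀.toSet \ R))
    (hv : ENNReal.ofReal γ * volume Q₀.toSet ≤ volume (Q₀.toSet \ R)) :
    IsSparse γ (insert Q₀ S) := by
  classical
  obtain ⟨F, hF, hFd⟩ := hS
  refine ⟨fun Q => if Q = Q₀ then Q₀.toSet \ R else F Q, ?_, ?_⟩
  · intro Q hQ
    by_cases h : Q = Q₀
    · subst h
      simpa using ⟨hm, hv⟩
    · simpa only [if_neg h] using hF Q (hQ.resolve_left h)
  · have key : ∀ Q ∈ S, Disjoint (Q₀.toSet \ R) (F Q) := fun Q hQ =>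
      disjoint_sdiff_left.mono_right ((hF Q hQ).2.1.trans (hSR Q hQ))
    intro Q hQ Q' hQ' hne
    by_cases h : Q = Q₀ <;> by_cases h' : Q' = Q₀
    · exact absurd (h.trans h'.symm) hne
    · simpa only [if_pos h, if_neg h'] using key Q' (hQ'.resolve_left h')
    · simpa only [if_pos h', if_neg h] using (key Q (hQ.resolve_left h)).symm
    · simpa only [if_neg h, if_neg h'] using
        hFd Q (hQ.resolve_left h) Q' (hQ'.resolve_left h') hne

lemma tsum_sparseForm_le {ι : Type*} {R : ι → Set (Euc d)}
    (hR : Pairwise (Function.onFun Disjoint R)) {S : ι → Set (Cube d)}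
    (hSR : ∀ i, ∀ Q ∈ S i, Q.toSet ⊆ R i) (p q s : ℝ) (f g h : Euc d → ℂ) :
    ∑' i, sparseForm (S i) p q s f g h ≤ sparseForm (⋃ i, S i) p q s f g h := by
  simp only [sparseForm]
  rw [← ENNReal.tsum_sigma (fun i (Q : S i) => volume (Q : Cube d).toSet * cubeAvg f Q p *
    cubeAvg g Q q * cubeAvg h Q s)]
  let e : (Σ i, S i) → (⋃ i, S i : Set (Cube d)) := fun x => ⟨x.2, mem_iUnion.2 ⟨x.1, x.2.2⟩⟩
  have he : Function.Injective e := by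
    rintro ⟨i, Q, hQ⟩ ⟨j, Q', hQ'⟩ hQQ
    have h1 : Q = Q' := congrArg Subtype.val hQQ
    subst h1
    have h2 := eq_of_mem_of_pairwise_disjoint hR hSR hQ hQ'
    subst h2
    rfl
  exact ENNReal.tsum_comp_le_tsum_of_injective he (fun Q : (⋃ i, S i : Set (Cube d)) =>
    volume (Q : Cube d).toSet * cubeAvg f Q p * cubeAvg g Q q * cubeAvg h Q s)

lemma sparseForm_insert {S : Set (Cube d)} {Q₀ : Cube d} (hQ : Q₀ ∉ S) (p q s : ℝ)
    (f g h : Euc d → ℂ) : sparseForm (insert Q₀ S) p q s f g h =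
      volume Q₀.toSet * cubeAvg f Q₀ p * cubeAvg g Q₀ q * cubeAvg h Q₀ s +
        sparseForm S p q s f g h := by
  let φ : Cube d → ℝ≥0∞ := fun Q =>
    volume Q.toSet * cubeAvg f Q p * cubeAvg g Q q * cubeAvg h Q s
  have h1 : ∑' Q : (insert Q₀ S : Set (Cube d)), φ Q = φ Q₀ + ∑' Q : S, φ Q := by
    rw [Set.insert_eq, ENNReal.summable.tsum_union_disjoint (by simpa using hQ) ENNReal.summable]
    simp
  exact h1

end Sparse

/-! ### Stopping cells -/

/-- A cell is bad if the average of `‖f‖ ^ p` or of `‖g‖ ^ q` over it exceeds `B` times the average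
over the top cell. -/
def BadCell {d : ℕ} (s : Fin d → ℝ) (f g : Euc d → ℂ) (p q : ℝ) (B : ℝ≥0∞) (K : ℤ)
    (m₀ : Fin d → ℤ) (l : ℤ) (m : Fin d → ℤ) : Prop :=
  B * (∫⁻ z in gridCell s K m₀, ‖f z‖ₑ ^ p) * cellVol d l <
      cellVol d K * ∫⁻ z in gridCell s l m, ‖f z‖ₑ ^ p ∨
    B * (∫⁻ z in gridCell s K m₀, ‖g z‖ₑ ^ q) * cellVol d l <
      cellVol d K * ∫⁻ z in gridCell s l m, ‖g z‖ₑ ^ q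

/-- The levels and indices of the stopping cells in the top cell. -/
def stopIndex {d : ℕ} (s : Fin d → ℝ) (bad : ℤ → (Fin d → ℤ) → Prop) {b K : ℤ} (hbK : b < K)
    (m₀ : Fin d → ℤ) : Set (ℤ × (Fin d → ℤ)) :=
  {a | ∃ x ∈ gridCell s K m₀, b < stopLevel s bad hbK x ∧ stopLevel s bad hbK x = a.1 ∧
    gridIdx s a.1 x = a.2}

section StopIndex

variable {d : ℕ} (s : Fin d → ℝ) (bad : ℤ → (Fin d → ℤ) → Prop) {b K : ℤ} (hbK : b < K)
  (m₀ : Fin d → ℤ)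

lemma stopLevel_of_mem_stopIndex {a : ℤ × (Fin d → ℤ)} (ha : a ∈ stopIndex s bad hbK m₀)
    {x : Euc d} (hx : x ∈ gridCell s a.1 a.2) : stopLevel s bad hbK x = a.1 := by
  obtain ⟨y, -, -, h2, h3⟩ := ha
  rw [← h2]
  refine stopLevel_eq_of_gridIdx_eq s bad hbK ?_
  rw [h2, h3]
  exact Eq.symm hx

lemma level_of_mem_stopIndex {a : ℤ × (Fin d → ℤ)} (ha : a ∈ stopIndex s bad hbK m₀) :
    b < a.1 ∧ a.1 < K := by
  obtain ⟨y, -, h1, h2, -⟩ := ha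
  rw [← h2]
  exact ⟨h1, stopLevel_lt s bad hbK y⟩

lemma bad_of_mem_stopIndex {a : ℤ × (Fin d → ℤ)} (ha : a ∈ stopIndex s bad hbK m₀) :
    bad a.1 a.2 := by
  obtain ⟨y, -, h1, h2, h3⟩ := ha
  have := bad_stopLevel s bad hbK h1
  rwa [h2, h3] at this

lemma gridCell_subset_of_mem_stopIndex {a : ℤ × (Fin d → ℤ)} (ha : a ∈ stopIndex s bad hbK m₀) :
    gridCell s a.1 a.2 ⊆ gridCell s K m₀ := by
  have h := (level_of_mem_stopIndex s bad hbK m₀ ha).2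
  obtain ⟨y, h0, -, -, h3⟩ := ha
  exact gridCell_subset s h.le h3 h0

lemma pairwise_disjoint_stopIndex : Pairwise (Function.onFun Disjoint
    fun a : stopIndex s bad hbK m₀ => gridCell s a.1.1 a.1.2) := by
  intro a a' h
  refine Set.disjoint_left.2 fun x hx hx' => h ?_
  have h1 := stopLevel_of_mem_stopIndex s bad hbK m₀ a.2 hx
  have h2 := stopLevel_of_mem_stopIndex s bad hbK m₀ a'.2 hx'
  have h3 : a.1.1 = a'.1.1 := h1.symm.trans h2
  refine Subtype.ext (Prod.ext h3 ?_)
  rw [← show gridIdx s a.1.1 x = a.1.2 from hx, ← show gridIdx s a'.1.1 x = a'.1.2 from hx', h3]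

lemma iUnion_stopIndex : ⋃ a : stopIndex s bad hbK m₀, gridCell s a.1.1 a.1.2 =
    gridCell s K m₀ ∩ {x | b < stopLevel s bad hbK x} := by
  ext x
  simp only [mem_iUnion]
  constructor
  · rintro ⟨a, hx⟩
    refine ⟨gridCell_subset_of_mem_stopIndex s bad hbK m₀ a.2 hx, ?_⟩
    rw [mem_ofPred_eq, stopLevel_of_mem_stopIndex s bad hbK m₀ a.2 hx]
    exact (level_of_mem_stopIndex s bad hbK m₀ a.2).1
  · rintro ⟨h1, h2⟩
    exact ⟨⟨(stopLevel s bad hbK x, gridIdx s (stopLevel s bad hbK x) x),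
      x, h1, h2, rfl, rfl⟩, rfl⟩

variable {f g : Euc d → ℂ} {p q : ℝ} {B : ℝ≥0∞}

/-- Stated for a generic function so that it serves both `f` and `g`. Below the top level the bound
is the failure of badness; at the top level it needs `1 ≤ B`. -/
lemma stoppedBound_badCell {f' : Euc d → ℂ} {p' : ℝ} (hB : 1 ≤ B)
    (h : ∀ l m, ¬ BadCell s f g p q B K m₀ l m →
      cellVol d K * ∫⁻ z in gridCell s l m, ‖f' z‖ₑ ^ p' ≤
        B * (∫⁻ z in gridCell s K m₀, ‖f' z‖ₑ ^ p') * cellVol d l) :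
    StoppedBound s (BadCell s f g p q B K m₀) hbK m₀ f' p'
      (B * ((cellVol d K)⁻¹ * ∫⁻ z in gridCell s K m₀, ‖f' z‖ₑ ^ p')) := by
  intro x hx k hk hkK
  have hv0 := cellVol_ne_zero (d := d) K
  have hvt := cellVol_ne_top (d := d) K
  have key : cellVol d K * ∫⁻ z in gridCell s k (gridIdx s k x), ‖f' z‖ₑ ^ p' ≤
      B * (∫⁻ z in gridCell s K m₀, ‖f' z‖ₑ ^ p') * cellVol d k := by
    rcases hkK.lt_or_eq with hlt | rfl
    · exact h _ _ (not_bad_of_stopLevel_lt s _ hbK hk hlt)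
    · rw [show gridIdx s k x = m₀ from hx, mul_comm]
      gcongr
      exact le_mul_of_one_le_left zero_le hB
  have h2 := mul_le_mul_right key (cellVol d K)⁻¹
  rw [← mul_assoc, ENNReal.inv_mul_cancel hv0 hvt, one_mul] at h2
  refine h2.trans (le_of_eq ?_)
  ring

/-- Each stopping cell is paid for by its share of `∫ |f|^p` or of `∫ |g|^q`. The cells are
disjoint, so each function's shares add up to at most `1`, whence the factor `2`. -/
lemma mul_volume_stopIndex_le (hB : B ≠ 0) :
    B * volume (gridCell s K m₀ ∩ {x | b < stopLevel s (BadCell s f g p q B K m₀) hbK x}) ≤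
      2 * cellVol d K := by
  rw [← iUnion_stopIndex, measure_iUnion (pairwise_disjoint_stopIndex s _ hbK m₀)
    (fun a => measurableSet_gridCell s _ _), ← ENNReal.tsum_mul_left]
  set V := cellVol d K
  set I := fun (f : Euc d → ℂ) (p : ℝ) => ∫⁻ z in gridCell s K m₀, ‖f z‖ₑ ^ p
  have hbd : ∀ (f : Euc d → ℂ) (p : ℝ) (l : ℤ) (m : Fin d → ℤ),
      gridCell s l m ⊆ gridCell s K m₀ →
      B * I f p * cellVol d l < V * ∫⁻ z in gridCell s l m, ‖f z‖ₑ ^ p →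
      -- Division is legitimate: the strict inequality fails if the integral over the top cell is
      -- `0` or `∞`.
      B * cellVol d l ≤ V * ((∫⁻ z in gridCell s l m, ‖f z‖ₑ ^ p) / I f p) := by
    intro f p l m hsub hlt
    have h0 : I f p ≠ 0 := by
      intro h0
      have : ∫⁻ z in gridCell s l m, ‖f z‖ₑ ^ p = 0 :=
        le_antisymm ((lintegral_mono_set hsub).trans h0.le) zero_le
      simp [this] at hlt
    have ht : I f p ≠ ∞ := by
      intro ht
      rw [ht, ENNReal.mul_top hB, ENNReal.top_mul (cellVol_ne_zero l)] at hlt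
      exact not_top_lt hlt
    rw [← mul_div_assoc, ENNReal.le_div_iff_mul_le (Or.inl h0) (Or.inl ht)]
    refine le_trans (le_of_eq ?_) hlt.le
    ring
  set J := stopIndex s (BadCell s f g p q B K m₀) hbK m₀
  have hone : ∀ (f : Euc d → ℂ) (p : ℝ),
      ∑' a : J, V * ((∫⁻ z in gridCell s a.1.1 a.1.2, ‖f z‖ₑ ^ p) / I f p) ≤ V := by
    intro f p
    simp_rw [div_eq_mul_inv]
    rw [ENNReal.tsum_mul_left, ENNReal.tsum_mul_right, ← lintegral_iUnion
      (fun a : J => measurableSet_gridCell s _ _) (pairwise_disjoint_stopIndex s _ hbK m₀)]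
    refine mul_le_of_le_one_right zero_le ?_
    refine le_trans ?_ (ENNReal.div_self_le_one (a := I f p))
    rw [div_eq_mul_inv]
    gcongr
    refine lintegral_mono_set (iUnion_subset fun a => ?_)
    exact gridCell_subset_of_mem_stopIndex s _ hbK m₀ a.2
  calc _ ≤ ∑' a : J, (V * ((∫⁻ z in gridCell s a.1.1 a.1.2, ‖f z‖ₑ ^ p) / I f p) +
          V * ((∫⁻ z in gridCell s a.1.1 a.1.2, ‖g z‖ₑ ^ q) / I g q)) := by
        refine ENNReal.tsum_le_tsum fun a => ?_
        rw [volume_gridCell]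
        have hsub := gridCell_subset_of_mem_stopIndex s _ hbK m₀ a.2
        rcases bad_of_mem_stopIndex s _ hbK m₀ a.2 with h | h
        · exact (hbd f p _ _ hsub h).trans le_self_add
        · exact (hbd g q _ _ hsub h).trans le_add_self
    _ ≤ V + V := by
        rw [ENNReal.tsum_add]
        exact add_le_add (hone f p) (hone g q)
    _ = 2 * V := (two_mul V).symm

end StopIndex

/-! ### Sparse domination on a grid -/

section Recursion

variable {d : ℕ} (μ : Measure (Euc d × Euc d)) [IsFiniteMeasure μ] (s : Fin d → ℝ)

/-- The maximal function over the levels `k` with `b < k ≤ K`, restricted to the points in the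
middle third of their cell. -/
noncomputable def gridMax (n₀ : ℕ) (f g : Euc d → ℂ) (b K : ℤ) (x : Euc d) : ℝ≥0∞ :=
  ⨆ k ∈ Finset.Ioc b K, (midCell s k).indicator
    (fun x => ‖bilinConv μ ((2 : ℝ) ^ (k - n₀)) f g x‖ₑ) x

/-- A level above the stopping level of `x` is active at `x`; any other level is among those of the
maximal function of the stopping cell containing `x`. -/
lemma lintegral_gridMax_le_add (bad : ℤ → (Fin d → ℤ) → Prop) {b K : ℤ} (hbK : b < K)
    (m₀ : Fin d → ℤ) (n₀ : ℕ) {f g : Euc d → ℂ} (hf : Measurable f) (hg : Measurable g)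
    {h : Euc d → ℝ≥0∞} (hh : Measurable h) :
    ∫⁻ x in gridCell s K m₀, gridMax μ s n₀ f g b K x * h x ≤
      (∫⁻ x in gridCell s K m₀, (⨆ k ∈ Finset.Ioc b K,
        (activeSet s bad hbK m₀ k ∩ midCell s k).indicator
          (fun x => ‖bilinConv μ ((2 : ℝ) ^ (k - n₀)) f g x‖ₑ) x) * h x) +
      ∑' a : stopIndex s bad hbK m₀,
        ∫⁻ x in gridCell s a.1.1 a.1.2, gridMax μ s n₀ f g b a.1.1 x * h x := by
  have hσ := measurable_stopLevel s bad hbK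
  set A : Euc d → ℝ≥0∞ := fun x => ⨆ k ∈ Finset.Ioc b K,
        (activeSet s bad hbK m₀ k ∩ midCell s k).indicator
          (fun x => ‖bilinConv μ ((2 : ℝ) ^ (k - n₀)) f g x‖ₑ) x
  have hA : Measurable A := Measurable.iSup fun k => Measurable.iSup fun _ =>
    (measurable_bilinConv μ hf hg _).enorm.indicator
      ((measurableSet_activeSet s bad hbK m₀ k).inter (measurableSet_midCell s k))
  have hb : MeasurableSet {x | b < stopLevel s bad hbK x} := hσ measurableSet_Ioi
  calc _ ≤ ∫⁻ x in gridCell s K m₀, (A x * h x + {x | b < stopLevel s bad hbK x}.indicator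
          (fun x => gridMax μ s n₀ f g b (stopLevel s bad hbK x) x * h x) x) := by
        refine setLIntegral_mono' (measurableSet_gridCell s K m₀) fun x hx => ?_
        have key : gridMax μ s n₀ f g b K x ≤ A x + {x | b < stopLevel s bad hbK x}.indicator
            (fun x => gridMax μ s n₀ f g b (stopLevel s bad hbK x) x) x := by
          refine iSup₂_le fun k hk => ?_
          by_cases hxk : x ∈ midCell s k
          · rcases lt_or_ge (stopLevel s bad hbK x) k with hlt | hge
            · refine le_trans ?_ le_self_add
              refine le_trans ?_ (le_iSup₂ (f := fun k _ =>
                (activeSet s bad hbK m₀ k ∩ midCell s k).indicator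
                  (fun x => ‖bilinConv μ ((2 : ℝ) ^ (k - n₀)) f g x‖ₑ) x) k hk)
              have hx2 : x ∈ activeSet s bad hbK m₀ k ∩ midCell s k := ⟨⟨hx, hlt⟩, hxk⟩
              rw [indicator_of_mem hxk, indicator_of_mem hx2]
            · refine le_trans ?_ le_add_self
              have hk2 := (Finset.mem_Ioc.1 hk).1
              have hx2 : x ∈ {x | b < stopLevel s bad hbK x} := hk2.trans_le hge
              rw [indicator_of_mem hx2]
              exact le_iSup₂ (f := fun k _ => (midCell s k).indicator
                (fun x => ‖bilinConv μ ((2 : ℝ) ^ (k - n₀)) f g x‖ₑ) x) k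
                (Finset.mem_Ioc.2 ⟨hk2, hge⟩)
          · rw [indicator_of_notMem hxk]
            exact zero_le
        refine (mul_le_mul' key le_rfl).trans (le_of_eq ?_)
        rw [add_mul, indicator_mul_left]
    _ = (∫⁻ x in gridCell s K m₀, A x * h x) +
          ∫⁻ x in gridCell s K m₀ ∩ {x | b < stopLevel s bad hbK x},
            gridMax μ s n₀ f g b (stopLevel s bad hbK x) x * h x := by
        rw [lintegral_add_left (show Measurable fun x => A x * h x from hA.mul hh),
          setLIntegral_indicator hb, inter_comm]
    _ = _ := by
        rw [← iUnion_stopIndex, lintegral_iUnion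
          (fun a => measurableSet_gridCell s _ _) (pairwise_disjoint_stopIndex s _ hbK m₀)]
        congr 1
        refine tsum_congr fun a => ?_
        refine setLIntegral_congr_fun (measurableSet_gridCell s _ _) fun x hx => ?_
        simp only [stopLevel_of_mem_stopIndex s bad hbK m₀ a.2 hx]

end Recursion

section Domination

variable {d : ℕ} (μ : Measure (Euc d × Euc d)) [IsFiniteMeasure μ]

lemma cubeAvg_gridCube (s : Fin d → ℝ) (k : ℤ) (m : Fin d → ℤ) (f : Euc d → ℂ) (p : ℝ) :
    cubeAvg f (gridCube s k m) p =
      ((cellVol d k)⁻¹ * ∫⁻ x in gridCell s k m, ‖f x‖ₑ ^ p) ^ (1 / p) := by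
  rw [cubeAvg, gridCube_toSet, volume_gridCell]

/-- Induction on the number of levels. The top cell joins the families of its stopping cells, and
its local estimate adds exactly one term to the form, so the constant does not grow. -/
lemma exists_isSparse_gridCell (s : Fin d → ℝ) (hd : 0 < d) {p q r : ℝ} {n₀ : ℕ}
    {D θ₁ θ₂ B : ℝ≥0∞} (hloc : LocalBound μ p q r n₀ D θ₁ θ₂) (hr : 1 < r) (hp : 1 ≤ p)
    (hq : 1 ≤ q) (hpr : p ≤ r) (hqr : q ≤ r)
    (hμ : ∀ᵐ w ∂μ, 3 * ‖w.1‖ ≤ 2 ^ n₀ ∧ 3 * ‖w.2‖ ≤ 2 ^ n₀) {γ : ℝ} (hγ : γ ∈ Ioo (0 : ℝ) 1)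
    (hB : B = ENNReal.ofReal (2 / (1 - γ))) {f g h : Euc d → ℂ} {N : ℝ}
    (hf : Measurable f) (hg : Measurable g) (hh : Measurable h)
    (hfN : ∀ z, ‖f z‖ ≤ N) (hgN : ∀ z, ‖g z‖ ≤ N) (b : ℤ) (n : ℕ) :
    ∀ K : ℤ, b < K → K ≤ b + n → ∀ m₀ : Fin d → ℤ, ∃ S : Set (Cube d), IsSparse γ S ∧
      (∀ Q ∈ S, Q.toSet ⊆ gridCell s K m₀) ∧
      ∫⁻ x in gridCell s K m₀, gridMax μ s n₀ f g b K x * ‖h x‖ₑ ≤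
        ((D + μ univ) * (1 - θ₁)⁻¹ * (1 - θ₂)⁻¹ *
          ((2 ^ p * (2 ^ (d + 1) * B)) ^ (1 / p) * (2 ^ q * (2 ^ (d + 1) * B)) ^ (1 / q))) *
        sparseForm S p q (r / (r - 1)) f g h := by
  induction n with
  | zero =>
    intro K h1 h2
    simp only [Nat.cast_zero, add_zero] at h2
    omega
  | succ n ih =>
    intro K hbK hKn m₀
    have hγ1 : 0 < 1 - γ := by linarith [hγ.2]
    have hp0 : 0 < p := by linarith
    have hq0 : 0 < q := by linarith
    have hr0 : 0 < r := by linarith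
    have hB1 : 1 ≤ B := by
      rw [hB, ENNReal.one_le_ofReal, one_le_div hγ1]
      linarith [hγ.1]
    have hB0 : B ≠ 0 := (one_pos.trans_le hB1).ne'
    have hv0 := cellVol_ne_zero (d := d) K
    have hvt := cellVol_ne_top (d := d) K
    set bad := BadCell s f g p q B K m₀
    have hc₁ : StoppedBound s bad hbK m₀ f p _ := stoppedBound_badCell s hbK m₀ hB1
      fun l m hlm => not_lt.1 (not_or.1 hlm).1
    have hc₂ : StoppedBound s bad hbK m₀ g q _ := stoppedBound_badCell s hbK m₀ hB1
      fun l m hlm => not_lt.1 (not_or.1 hlm).2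
    have htop := lintegral_iSup_activeSet_le μ s bad hbK hd hloc hr hp hq hpr hqr hf hg hfN hgN hμ
      hc₁ hc₂ hh.enorm
    set C₀ := ((D + μ univ) * (1 - θ₁)⁻¹ * (1 - θ₂)⁻¹ *
          ((2 ^ p * (2 ^ (d + 1) * B)) ^ (1 / p) * (2 ^ q * (2 ^ (d + 1) * B)) ^ (1 / q)))
    have hih : ∀ a : stopIndex s bad hbK m₀, ∃ S : Set (Cube d), IsSparse γ S ∧
        (∀ Q ∈ S, Q.toSet ⊆ gridCell s a.1.1 a.1.2) ∧
        ∫⁻ x in gridCell s a.1.1 a.1.2, gridMax μ s n₀ f g b a.1.1 x * ‖h x‖ₑ ≤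
          C₀ * sparseForm S p q (r / (r - 1)) f g h := by
      intro a
      have h1 := level_of_mem_stopIndex s bad hbK m₀ a.2
      push_cast at hKn
      exact ih a.1.1 h1.1 (by omega) a.1.2
    choose S hS hSR hSM using hih
    have hR := pairwise_disjoint_stopIndex s bad hbK m₀
    set R : Set (Euc d) := gridCell s K m₀ ∩ {x | b < stopLevel s bad hbK x}
    have hRm : MeasurableSet R :=
      (measurableSet_gridCell s K m₀).inter (measurable_stopLevel s bad hbK measurableSet_Ioi)
    have hSR' : ∀ Q ∈ ⋃ a, S a, Q.toSet ⊆ R := by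
      intro Q hQ
      obtain ⟨a, ha⟩ := mem_iUnion.1 hQ
      rw [show R = _ from (iUnion_stopIndex s bad hbK m₀).symm]
      exact (hSR a Q ha).trans (subset_iUnion_of_subset a subset_rfl)
    have hRv : volume R ≤ ENNReal.ofReal (1 - γ) * cellVol d K := by
      have h1 : B * volume R ≤ 2 * cellVol d K := mul_volume_stopIndex_le s hbK m₀ hB0
      have h2 := mul_le_mul_right h1 (ENNReal.ofReal ((1 - γ) / 2))
      rw [hB, ← mul_assoc, ← mul_assoc, ← ENNReal.ofReal_mul (by positivity),
        show (1 - γ) / 2 * (2 / (1 - γ)) = 1 by field_simp, ENNReal.ofReal_one, one_mul,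
        show ENNReal.ofReal ((1 - γ) / 2) * 2 = ENNReal.ofReal (1 - γ) by
          rw [ENNReal.ofReal_div_of_pos two_pos, ENNReal.ofReal_ofNat,
            ENNReal.div_mul_cancel two_ne_zero ENNReal.ofNat_ne_top]] at h2
      exact h2
    have hQv : ENNReal.ofReal γ * volume (gridCube s K m₀).toSet ≤
        volume ((gridCube s K m₀).toSet \ R) := by
      rw [gridCube_toSet, measure_sdiff inter_subset_left hRm.nullMeasurableSet
        (ne_top_of_le_ne_top (by rw [volume_gridCell]; exact hvt) (measure_mono inter_subset_left)),
        volume_gridCell]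
      refine ENNReal.le_sub_of_add_le_right
        (ne_top_of_le_ne_top (ENNReal.mul_ne_top ENNReal.ofReal_ne_top hvt) hRv) ?_
      refine (add_le_add le_rfl hRv).trans (le_of_eq ?_)
      rw [← add_mul, ← ENNReal.ofReal_add hγ.1.le hγ1.le]
      simp
    -- Otherwise the top cell would lie in the union of the stopping cells, leaving no room for its
    -- sparse part.
    have hnot : gridCube s K m₀ ∉ ⋃ a, S a := by
      intro hmem
      have h1 := hSR' _ hmem
      rw [sdiff_eq_empty.2 h1, measure_empty, gridCube_toSet, volume_gridCell] at hQv
      have h2 : ENNReal.ofReal γ * cellVol d K ≠ 0 :=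
        mul_ne_zero (by simpa using hγ.1) hv0
      exact h2 (le_antisymm hQv zero_le)
    refine ⟨insert (gridCube s K m₀) (⋃ a, S a), ?_, ?_, ?_⟩
    · refine (IsSparse.iUnion hR hSR hS).insert hSR' ?_ hQv
      rw [gridCube_toSet]
      exact (measurableSet_gridCell s K m₀).diff hRm
    · rintro Q (rfl | hQ)
      · rw [gridCube_toSet]
      · exact (hSR' Q hQ).trans inter_subset_left
    · refine (lintegral_gridMax_le_add μ s bad hbK m₀ n₀ hf hg hh.enorm).trans ?_
      rw [sparseForm_insert hnot, mul_add]
      refine add_le_add ?_ ?_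
      · refine htop.trans (le_of_eq ?_)
        have e1 : ∀ (a : ℝ≥0∞) {p : ℝ}, 0 < p → (2 ^ p * (2 ^ (d + 1) * (B * a))) ^ (1 / p) =
            (2 ^ p * (2 ^ (d + 1) * B)) ^ (1 / p) * a ^ (1 / p) := by
          intro a p hp
          rw [← ENNReal.mul_rpow_of_nonneg _ _ (by positivity)]
          congr 1
          ring
        -- The exponents match because `1 / r = 1 - 1 / r'` with `r' = r / (r - 1)`.
        have e2 : cellVol d K ^ (1 / r) *
            (∫⁻ x in gridCell s K m₀, ‖h x‖ₑ ^ (r / (r - 1))) ^ (1 / (r / (r - 1))) =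
            cellVol d K * ((cellVol d K)⁻¹ *
              ∫⁻ x in gridCell s K m₀, ‖h x‖ₑ ^ (r / (r - 1))) ^ (1 / (r / (r - 1))) := by
          have hr1 : 0 < r - 1 := by linarith
          rw [ENNReal.mul_rpow_of_nonneg _ _ (by positivity), ← mul_assoc, ENNReal.inv_rpow,
            ← ENNReal.rpow_neg]
          congr 1
          nth_rewrite 2 [← ENNReal.rpow_one (cellVol d K)]
          rw [← ENNReal.rpow_add _ _ hv0 hvt]
          congr 1
          field_simp
          ring
        rw [cubeAvg_gridCube, cubeAvg_gridCube, cubeAvg_gridCube, gridCube_toSet, volume_gridCell,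
          e1 _ hp0, e1 _ hq0, e2]
        ring
      · refine le_trans ?_ (mul_le_mul_right (tsum_sparseForm_le hR hSR _ _ _ _ _ _) C₀)
        rw [← ENNReal.tsum_mul_left]
        exact ENNReal.tsum_le_tsum hSM

lemma lintegral_gridMax_le (s : Fin d → ℝ) (hd : 0 < d) {p q r : ℝ} {n₀ : ℕ}
    {D θ₁ θ₂ B : ℝ≥0∞} (hloc : LocalBound μ p q r n₀ D θ₁ θ₂) (hr : 1 < r) (hp : 1 ≤ p)
    (hq : 1 ≤ q) (hpr : p ≤ r) (hqr : q ≤ r)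
    (hμ : ∀ᵐ w ∂μ, 3 * ‖w.1‖ ≤ 2 ^ n₀ ∧ 3 * ‖w.2‖ ≤ 2 ^ n₀) {γ : ℝ} (hγ : γ ∈ Ioo (0 : ℝ) 1)
    (hB : B = ENNReal.ofReal (2 / (1 - γ))) {f g h : Euc d → ℂ} {N : ℝ}
    (hf : Measurable f) (hg : Measurable g) (hh : Measurable h)
    (hfN : ∀ z, ‖f z‖ ≤ N) (hgN : ∀ z, ‖g z‖ ≤ N) {b K : ℤ} (hbK : b < K) :
    ∫⁻ x, gridMax μ s n₀ f g b K x * ‖h x‖ₑ ≤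
      ((D + μ univ) * (1 - θ₁)⁻¹ * (1 - θ₂)⁻¹ *
          ((2 ^ p * (2 ^ (d + 1) * B)) ^ (1 / p) * (2 ^ q * (2 ^ (d + 1) * B)) ^ (1 / q))) *
        ⨆ S : {S : Set (Cube d) // IsSparse γ S},
          sparseForm (S : Set (Cube d)) p q (r / (r - 1)) f g h := by
  have hex := exists_isSparse_gridCell μ s hd hloc hr hp hq hpr hqr hμ hγ hB hf hg hh hfN hgN b
    (K - b).toNat K hbK (by omega)
  choose S hS hSR hSM using hex
  have hR : Pairwise (Function.onFun Disjoint (gridCell s K)) := fun m m' h =>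
    disjoint_gridCell s h
  rw [← setLIntegral_univ, setLIntegral_eq_tsum_gridCell s K MeasurableSet.univ]
  simp only [univ_inter]
  refine (ENNReal.tsum_le_tsum hSM).trans ?_
  rw [ENNReal.tsum_mul_left]
  gcongr
  refine (tsum_sparseForm_le hR hSR _ _ _ _ _ _).trans ?_
  exact le_iSup (fun S : {S : Set (Cube d) // IsSparse γ S} =>
    sparseForm (S : Set (Cube d)) p q (r / (r - 1)) f g h) ⟨⋃ m, S m, IsSparse.iUnion hR hSR hS⟩

lemma exists_gridMax_bound (hd : 0 < d) {p q r : ℝ} (hr : 1 < r) (hp : 1 ≤ p) (hq : 1 ≤ q)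
    (hpr : p ≤ r) (hqr : q ≤ r) (hcont : ContinuityEstimate μ p q r) {n₀ : ℕ}
    (hμ : ∀ᵐ w ∂μ, 3 * ‖w.1‖ ≤ 2 ^ n₀ ∧ 3 * ‖w.2‖ ≤ 2 ^ n₀) {γ : ℝ} (hγ : γ ∈ Ioo (0 : ℝ) 1) :
    ∃ C : ℝ≥0∞, C ≠ ∞ ∧ ∀ (s : Fin d → ℝ) (f g h : Euc d → ℂ) (N : ℝ), Measurable f →
      Measurable g → Measurable h → (∀ z, ‖f z‖ ≤ N) → (∀ z, ‖g z‖ ≤ N) → ∀ b K : ℤ, b < K →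
      ∫⁻ x, gridMax μ s n₀ f g b K x * ‖h x‖ₑ ≤
        C * ⨆ S : {S : Set (Cube d) // IsSparse γ S},
          sparseForm (S : Set (Cube d)) p q (r / (r - 1)) f g h := by
  obtain ⟨D, θ₁, θ₂, hD, hθ₁, hθ₂, hloc⟩ :=
    exists_localBound μ hd (by linarith) (by linarith) hr hcont hμ
  refine ⟨_, ?_, fun s f g h N hf hg hh hfN hgN b K hbK =>
    lintegral_gridMax_le μ s hd hloc hr hp hq hpr hqr hμ hγ rfl hf hg hh hfN hgN hbK⟩
  have hg : ∀ {p : ℝ}, 1 ≤ p →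
      (2 ^ p * (2 ^ (d + 1) * ENNReal.ofReal (2 / (1 - γ)))) ^ (1 / p) ≠ ∞ := fun hp =>
    ENNReal.rpow_ne_top_of_nonneg (by positivity) (ENNReal.mul_ne_top
      (ENNReal.rpow_ne_top_of_nonneg (by linarith) (by simp))
      (ENNReal.mul_ne_top (by simp) ENNReal.ofReal_ne_top))
  refine ENNReal.mul_ne_top (ENNReal.mul_ne_top
    (ENNReal.mul_ne_top (ENNReal.add_ne_top.2 ⟨hD, measure_ne_top _ _⟩) ?_) ?_)
    (ENNReal.mul_ne_top (hg hp) (hg hq))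
  · exact ENNReal.inv_ne_top.2 (tsub_pos_of_lt hθ₁).ne'
  · exact ENNReal.inv_ne_top.2 (tsub_pos_of_lt hθ₂).ne'

/-! ### The one-third trick -/

/-- As `2 ^ n` is invertible modulo `3`, some `a` makes `⌊3 y⌋ - a 2 ^ n` congruent to `1` modulo
`3`, which is the middle third. -/
lemma exists_fract_mem_third (y : ℝ) (n : ℕ) :
    ∃ a : Fin 3, Int.fract (y - a * 2 ^ n / 3) ∈ Ico (1 / 3 : ℝ) (2 / 3) := by
  have h1 : ∃ a : Fin 3, ∃ j : ℤ, ⌊3 * y⌋ - (a : ℕ) * 2 ^ n = 3 * j + 1 := by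
    have h2 : (2 : ℤ) ^ n % 3 = 1 ∨ (2 : ℤ) ^ n % 3 = 2 := by
      induction n with
      | zero => simp
      | succ n ih => rw [pow_succ]; omega
    generalize (2 : ℤ) ^ n = M at h2
    generalize ⌊3 * y⌋ = c
    have h3 : c % 3 = 0 ∨ c % 3 = 1 ∨ c % 3 = 2 := by omega
    rcases h2 with h2 | h2 <;> rcases h3 with h3 | h3 | h3
    · exact ⟨2, (c - 2 * M - 1) / 3, by norm_num; omega⟩
    · exact ⟨0, (c - 1) / 3, by norm_num; omega⟩
    · exact ⟨1, (c - M - 1) / 3, by norm_num; omega⟩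
    · exact ⟨1, (c - M - 1) / 3, by norm_num; omega⟩
    · exact ⟨0, (c - 1) / 3, by norm_num; omega⟩
    · exact ⟨2, (c - 2 * M - 1) / 3, by norm_num; omega⟩
  obtain ⟨a, j, h⟩ := h1
  refine ⟨a, ?_⟩
  have h2 : ((⌊3 * y⌋ : ℤ) : ℝ) - (a : ℕ) * 2 ^ n = 3 * j + 1 := by exact_mod_cast h
  have h3 := Int.floor_le (3 * y)
  have h4 := Int.lt_floor_add_one (3 * y)
  have hfl : ⌊y - (a : ℕ) * 2 ^ n / 3⌋ = j := by
    rw [Int.floor_eq_iff]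
    constructor <;> linarith
  rw [Int.fract, hfl]
  constructor <;> linarith

/-- The origins depend on `K` but not on `k`, so the same `3 ^ d` nested grids serve all levels up
to `K`. -/
lemma exists_mem_midCell {k K : ℤ} (hk : k ≤ K) (x : Euc d) :
    ∃ a : Fin d → Fin 3, x ∈ midCell (fun i => (a i : ℝ) * 2 ^ K / 3) k := by
  obtain ⟨n, rfl⟩ := Int.le.dest hk
  choose a ha using fun i => exists_fract_mem_third (x i / (2 : ℝ) ^ k) n
  refine ⟨a, fun i => ?_⟩
  convert ha i using 2
  rw [zpow_add₀ two_ne_zero, zpow_natCast]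
  field_simp

lemma measurable_gridMax (s : Fin d → ℝ) (n₀ : ℕ) {f g : Euc d → ℂ} (hf : Measurable f)
    (hg : Measurable g) (b K : ℤ) : Measurable (gridMax μ s n₀ f g b K) :=
  Measurable.iSup fun k => Measurable.iSup fun _ =>
    (measurable_bilinConv μ hf hg _).enorm.indicator (measurableSet_midCell s k)

lemma lintegral_iSup_bilinConv_le {p q r : ℝ} {n₀ : ℕ} {C : ℝ≥0∞} {γ : ℝ}
    {f g h : Euc d → ℂ} (hf : Measurable f) (hg : Measurable g) (hh : Measurable h)
    (hC : ∀ (s : Fin d → ℝ) (b K : ℤ), b < K → ∫⁻ x, gridMax μ s n₀ f g b K x * ‖h x‖ₑ ≤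
      C * ⨆ S : {S : Set (Cube d) // IsSparse γ S},
          sparseForm (S : Set (Cube d)) p q (r / (r - 1)) f g h) (N : ℕ) :
    ∫⁻ x, (⨆ j ∈ Finset.Icc (-N : ℤ) N, ‖bilinConv μ ((2 : ℝ) ^ j) f g x‖ₑ) * ‖h x‖ₑ ≤
      3 ^ d * C * ⨆ S : {S : Set (Cube d) // IsSparse γ S},
          sparseForm (S : Set (Cube d)) p q (r / (r - 1)) f g h := by
  -- The scale `2 ^ j` belongs to the level `k = j + n₀`, and levels range over `(b, K]`, so `|j| ≤
  -- N` is covered exactly.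
  set b : ℤ := n₀ - N - 1 with hb
  set K : ℤ := n₀ + N with hK
  let s : (Fin d → Fin 3) → Fin d → ℝ := fun a i => (a i : ℝ) * 2 ^ K / 3
  have hm : ∀ a, Measurable fun x => gridMax μ (s a) n₀ f g b K x * ‖h x‖ₑ := fun a =>
    (measurable_gridMax μ (s a) n₀ hf hg b K).mul hh.enorm
  calc _ ≤ ∫⁻ x, ∑ a, gridMax μ (s a) n₀ f g b K x * ‖h x‖ₑ := by
        gcongr with x
        rw [← Finset.sum_mul]
        gcongr
        refine iSup₂_le fun j hj => ?_
        rw [Finset.mem_Icc] at hj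
        obtain ⟨a, ha⟩ := exists_mem_midCell (d := d) (k := j + n₀) (K := K) (by omega) x
        refine le_trans ?_ (Finset.single_le_sum (f := fun a => gridMax μ (s a) n₀ f g b K x)
          (fun _ _ => zero_le) (Finset.mem_univ a))
        refine le_trans ?_ (le_iSup₂ (f := fun k _ => (midCell (s a) k).indicator
          (fun x => ‖bilinConv μ ((2 : ℝ) ^ (k - n₀)) f g x‖ₑ) x) (j + n₀)
          (Finset.mem_Ioc.2 ⟨by omega, by omega⟩))
        rw [indicator_of_mem ha, add_sub_cancel_right]
    _ = ∑ a, ∫⁻ x, gridMax μ (s a) n₀ f g b K x * ‖h x‖ₑ := lintegral_finsetSum _ fun a _ => hm a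
    _ ≤ ∑ _a : Fin d → Fin 3, C * ⨆ S : {S : Set (Cube d) // IsSparse γ S},
          sparseForm (S : Set (Cube d)) p q (r / (r - 1)) f g h :=
        Finset.sum_le_sum fun a _ => hC (s a) b K (by omega)
    _ = _ := by
        simp [mul_assoc]

end Domination

/-! ### Truncation -/

/-- The truncation `min (|f|, N)` of `|f|`. -/
noncomputable def truncAbs {d : ℕ} (f : Euc d → ℂ) (N : ℕ) (x : Euc d) : ℂ :=
  ((min ‖f x‖ N : ℝ) : ℂ)

section Truncation

variable {d : ℕ} (μ : Measure (Euc d × Euc d))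

lemma enorm_truncAbs (f : Euc d → ℂ) (N : ℕ) (x : Euc d) :
    ‖truncAbs f N x‖ₑ = min ‖f x‖ₑ N := by
  have h0 : 0 ≤ min ‖f x‖ (N : ℝ) := le_min (norm_nonneg _) (Nat.cast_nonneg N)
  rw [truncAbs, ← ofReal_norm, Complex.norm_real, Real.norm_of_nonneg h0,
    ENNReal.ofReal_min, ofReal_norm, ENNReal.ofReal_natCast]

lemma measurable_truncAbs {f : Euc d → ℂ} (hf : Measurable f) (N : ℕ) :
    Measurable (truncAbs f N) :=
  Complex.measurable_ofReal.comp (hf.norm.min measurable_const)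

lemma norm_truncAbs_le (f : Euc d → ℂ) (N : ℕ) (x : Euc d) : ‖truncAbs f N x‖ ≤ N := by
  have h0 : 0 ≤ min ‖f x‖ (N : ℝ) := le_min (norm_nonneg _) (Nat.cast_nonneg N)
  rw [truncAbs, Complex.norm_real, Real.norm_of_nonneg h0]
  exact min_le_right _ _

lemma enorm_bilinConv_truncAbs [IsFiniteMeasure μ] {f g : Euc d → ℂ} (hf : Measurable f)
    (hg : Measurable g)
    (N : ℕ) (t : ℝ) (x : Euc d) : ‖bilinConv μ t (truncAbs f N) (truncAbs g N) x‖ₑ =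
      ∫⁻ w, min ‖f (x - t • w.1)‖ₑ N * min ‖g (x - t • w.2)‖ₑ N ∂μ := by
  have hint := integrable_bilinConv μ (measurable_truncAbs hf N) (measurable_truncAbs hg N)
    (norm_truncAbs_le f N) (norm_truncAbs_le g N) t x
  let F : Euc d × Euc d → ℝ := fun w => min ‖f (x - t • w.1)‖ N * min ‖g (x - t • w.2)‖ N
  have hF0 : ∀ w, 0 ≤ F w := fun w => mul_nonneg (le_min (norm_nonneg _) (Nat.cast_nonneg N))
    (le_min (norm_nonneg _) (Nat.cast_nonneg N))
  have hFeq : ∀ w : Euc d × Euc d,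
      truncAbs f N (x - t • w.1) * truncAbs g N (x - t • w.2) = (F w : ℂ) := fun w => by
    simp [F, truncAbs]
  have hFn : ∀ w, F w = ‖truncAbs f N (x - t • w.1) * truncAbs g N (x - t • w.2)‖ := fun w => by
    rw [hFeq, Complex.norm_real, Real.norm_of_nonneg (hF0 w)]
  have hFint : Integrable F μ := by
    have := hint.norm
    rwa [← funext hFn] at this
  rw [bilinConv]
  simp_rw [hFeq]
  rw [integral_complex_ofReal, ← ofReal_norm, Complex.norm_real,
    Real.norm_of_nonneg (integral_nonneg hF0),
    ofReal_integral_eq_lintegral_ofReal hFint (ae_of_all _ hF0)]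
  refine lintegral_congr fun w => ?_
  rw [hFn, ofReal_norm, enorm_mul, enorm_truncAbs, enorm_truncAbs]

lemma iSup_enorm_bilinConv_truncAbs [IsFiniteMeasure μ] {f g : Euc d → ℂ} (hf : Measurable f)
    (hg : Measurable g)
    (t : ℝ) (x : Euc d) : ⨆ N : ℕ, ‖bilinConv μ t (truncAbs f N) (truncAbs g N) x‖ₑ =
      ∫⁻ w, ‖f (x - t • w.1)‖ₑ * ‖g (x - t • w.2)‖ₑ ∂μ := by
  have hmin : ∀ {f : Euc d → ℂ}, Measurable f → ∀ (N : ℕ) {X : Euc d × Euc d → Euc d},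
      Measurable X → Measurable fun w => min ‖f (X w)‖ₑ (N : ℝ≥0∞) := fun hf N X hX =>
    ((hf.comp hX).enorm).min measurable_const
  simp_rw [enorm_bilinConv_truncAbs μ hf hg]
  rw [← lintegral_iSup]
  · refine lintegral_congr fun w => ?_
    have hs : ∀ a : ℝ≥0∞, a ≠ ∞ → ∃ M : ℕ, a ≤ M := fun a ha => by
      obtain ⟨M, hM⟩ := ENNReal.exists_nat_gt ha
      exact ⟨M, hM.le⟩
    refine le_antisymm (iSup_le fun N => mul_le_mul' (min_le_left _ _) (min_le_left _ _)) ?_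
    obtain ⟨M₁, h1⟩ := hs ‖f (x - t • w.1)‖ₑ enorm_ne_top
    obtain ⟨M₂, h2⟩ := hs ‖g (x - t • w.2)‖ₑ enorm_ne_top
    refine le_iSup_of_le (max M₁ M₂) (le_of_eq ?_)
    rw [min_eq_left (h1.trans (by exact_mod_cast le_max_left _ _)),
      min_eq_left (h2.trans (by exact_mod_cast le_max_right _ _))]
  · exact fun N => (hmin hf N (by fun_prop)).mul (hmin hg N (by fun_prop))
  · intro N M hNM w
    have : (N : ℝ≥0∞) ≤ M := by exact_mod_cast hNM
    exact mul_le_mul' (min_le_min_left _ this) (min_le_min_left _ this)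

/-- Passage to Borel representatives, not automatic since `μ` may be singular. Translation
invariance makes `(x, w) ↦ x - t • Y w` quasi-measure-preserving, so the exceptional null set is
missed for almost every `x` and `μ`-almost every `w`. -/
lemma ae_enorm_bilinConv_le [IsFiniteMeasure μ] {f g f₁ g₁ : Euc d → ℂ} (hf : f =ᵐ[volume] f₁)
    (hg : g =ᵐ[volume] g₁)
    (t : ℝ) : ∀ᵐ x, ‖bilinConv μ t f g x‖ₑ ≤
      ∫⁻ w, ‖f₁ (x - t • w.1)‖ₑ * ‖g₁ (x - t • w.2)‖ₑ ∂μ := by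
  have key : ∀ {Y : Euc d × Euc d → Euc d}, Measurable Y → ∀ {f f₁ : Euc d → ℂ},
      f =ᵐ[volume] f₁ → ∀ᵐ x, ∀ᵐ w ∂μ, f (x - t • Y w) = f₁ (x - t • Y w) := by
    intro Y hY f f₁ hf
    have hq : Measure.QuasiMeasurePreserving
        (fun a : Euc d × (Euc d × Euc d) => a.1 - t • Y a.2) (volume.prod μ) volume := by
      refine QuasiMeasurePreserving.prod_of_left (by fun_prop) (ae_of_all _ fun w => ?_)
      exact (measurePreserving_sub_right volume (t • Y w)).quasiMeasurePreserving
    exact Measure.ae_ae_of_ae_prod (hq.ae hf)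
  filter_upwards [key measurable_fst hf, key measurable_snd hg] with x h1 h2
  refine (enorm_integral_le_lintegral_enorm _).trans (lintegral_mono_ae ?_)
  filter_upwards [h1, h2] with w e1 e2
  rw [enorm_mul, e1, e2]

/-- The truncated maximal function `sup_{|j| ≤ N} |L_{2^j}(min (|f|, N), min (|g|, N))|`. -/
noncomputable def truncMax (f g : Euc d → ℂ) (N : ℕ) (x : Euc d) : ℝ≥0∞ :=
  ⨆ j ∈ Finset.Icc (-N : ℤ) N, ‖bilinConv μ ((2 : ℝ) ^ j) (truncAbs f N) (truncAbs g N) x‖ₑ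

lemma measurable_truncMax [IsFiniteMeasure μ] {f g : Euc d → ℂ} (hf : Measurable f)
    (hg : Measurable g) (N : ℕ) :
    Measurable (truncMax μ f g N) :=
  Measurable.iSup fun _ => Measurable.iSup fun _ =>
    (measurable_bilinConv μ (measurable_truncAbs hf N) (measurable_truncAbs hg N) _).enorm

lemma monotone_enorm_bilinConv_truncAbs [IsFiniteMeasure μ] {f g : Euc d → ℂ} (hf : Measurable f)
    (hg : Measurable g)
    (t : ℝ) (x : Euc d) :
    Monotone fun N : ℕ => ‖bilinConv μ t (truncAbs f N) (truncAbs g N) x‖ₑ := by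
  intro N M hNM
  simp only [enorm_bilinConv_truncAbs μ hf hg]
  have : (N : ℝ≥0∞) ≤ M := by exact_mod_cast hNM
  gcongr

lemma enorm_bilinConv_le_truncMax (f g : Euc d → ℂ) {N : ℕ} {j : ℤ} (h₁ : -N ≤ j) (h₂ : j ≤ N)
    (x : Euc d) :
    ‖bilinConv μ ((2 : ℝ) ^ j) (truncAbs f N) (truncAbs g N) x‖ₑ ≤ truncMax μ f g N x := by
  rw [truncMax]
  exact le_iSup₂_of_le j (Finset.mem_Icc.2 ⟨h₁, h₂⟩) le_rfl

lemma monotone_truncMax [IsFiniteMeasure μ] {f g : Euc d → ℂ} (hf : Measurable f)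
    (hg : Measurable g) (x : Euc d) :
    Monotone fun N => truncMax μ f g N x := by
  intro N M hNM
  refine iSup₂_le fun j hj => ?_
  rw [Finset.mem_Icc] at hj
  exact (monotone_enorm_bilinConv_truncAbs μ hf hg _ x hNM).trans
    (enorm_bilinConv_le_truncMax μ f g (by omega) (by omega) x)

lemma ae_lacunaryMax_le [IsFiniteMeasure μ] {f g f₁ g₁ : Euc d → ℂ} (hf₁ : Measurable f₁)
    (hg₁ : Measurable g₁)
    (hf : f =ᵐ[volume] f₁) (hg : g =ᵐ[volume] g₁) :
    ∀ᵐ x, lacunaryMax μ f g x ≤ ⨆ N, truncMax μ f₁ g₁ N x := by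
  filter_upwards [ae_all_iff.2 fun j : ℤ => ae_enorm_bilinConv_le μ hf hg ((2 : ℝ) ^ j)] with x hx
  refine iSup_le fun j => (hx j).trans ?_
  rw [← iSup_enorm_bilinConv_truncAbs μ hf₁ hg₁]
  refine iSup_le fun N => ?_
  -- Raising the truncation to at least `|j|` brings the scale `2 ^ j` into the truncated supremum.
  have h1 : j.natAbs ≤ max N j.natAbs := le_max_right _ _
  exact (monotone_enorm_bilinConv_truncAbs μ hf₁ hg₁ _ x (le_max_left N j.natAbs)).trans
    (le_iSup_of_le (max N j.natAbs)
      (enorm_bilinConv_le_truncMax μ f₁ g₁ (by omega) (by omega) x))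

end Truncation

/-! ### Sparse domination for locally integrable functions -/

lemma cubeAvg_mono {d : ℕ} {φ ψ : Euc d → ℂ} (h : ∀ᵐ x, ‖φ x‖ₑ ≤ ‖ψ x‖ₑ) (Q : Cube d) {s : ℝ}
    (hs : 0 ≤ s) : cubeAvg φ Q s ≤ cubeAvg ψ Q s := by
  refine ENNReal.rpow_le_rpow ?_ (by positivity)
  gcongr 1
  exact lintegral_mono_ae ((ae_restrict_of_ae h).mono fun x hx => ENNReal.rpow_le_rpow hx hs)

theorem theorem2 (d : ℕ) (hd : 0 < d)
    (μ : Measure (EuclideanSpace ℝ (Fin d) × EuclideanSpace ℝ (Fin d))) [IsFiniteMeasure μ]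
    (hsupp : ∃ K : Set (EuclideanSpace ℝ (Fin d) × EuclideanSpace ℝ (Fin d)),
      IsCompact K ∧ μ Kᶜ = 0)
    -- some improving estimate
    (himp : ∃ a b c : ℝ, (a, b, c) ∈ boundednessSet μ ∧ c < a + b)
    -- continuity estimates throughout the interior of the boundedness set
    (hcont : ∀ p q r : ℝ, (1 / p, 1 / q, 1 / r) ∈ interior (boundednessSet μ) →
      ContinuityEstimate μ p q r)
    (p q r : ℝ) (hpqr : (1 / p, 1 / q, 1 / r) ∈ interior (boundednessSet μ))
    (hpr : p ≤ r) (hqr : q ≤ r) (hr : 1 < r)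
    (γ : ℝ) (hγ : γ ∈ Ioo (0 : ℝ) 1) :
    ∃ C : ℝ≥0, ∀ f g h : EuclideanSpace ℝ (Fin d) → ℂ,
      LocallyIntegrable f volume → LocallyIntegrable g volume → LocallyIntegrable h volume →
      ∫⁻ x, lacunaryMax μ f g x * ‖h x‖ₑ ≤
        C * ⨆ S : {S : Set (Cube d) // IsSparse γ S},
          sparseForm (S : Set (Cube d)) p q (r / (r - 1)) f g h := by
  have hr1 : 0 < r - 1 := by linarith
  have hr0 : 0 < r := by linarith
  -- Interior points of the boundedness set have their first two coordinates in the open interval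
  -- `(0, 1)`.
  have hpq : 1 ≤ p ∧ 1 ≤ q := by
    have hsub : boundednessSet μ ⊆ Icc (0 : ℝ) 1 ×ˢ (Icc (0 : ℝ) 1 ×ˢ univ) :=
      fun v hv => ⟨hv.1, hv.2.1, mem_univ _⟩
    have h1 := interior_mono hsub hpqr
    rw [interior_prod_eq, interior_prod_eq, interior_Icc] at h1
    have key : ∀ a : ℝ, 1 / a ∈ Ioo (0 : ℝ) 1 → 1 ≤ a := by
      intro a ha
      have ha0 : 0 < a := one_div_pos.1 ha.1
      have := ha.2
      rw [div_lt_one ha0] at this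
      exact this.le
    exact ⟨key p h1.1, key q h1.2.1⟩
  obtain ⟨hp, hq⟩ := hpq
  obtain ⟨n₀, hμ⟩ : ∃ n₀ : ℕ, ∀ᵐ w ∂μ, 3 * ‖w.1‖ ≤ 2 ^ n₀ ∧ 3 * ‖w.2‖ ≤ 2 ^ n₀ := by
    obtain ⟨K, hK, hμK⟩ := hsupp
    obtain ⟨R, hR⟩ := hK.isBounded.exists_norm_le
    obtain ⟨n₀, hn₀⟩ := pow_unbounded_of_one_lt (3 * R) (one_lt_two : (1 : ℝ) < 2)
    refine ⟨n₀, ?_⟩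
    have hae : ∀ᵐ w ∂μ, w ∈ K := hμK
    filter_upwards [hae] with w hw
    have h1 := (norm_fst_le w).trans (hR w hw)
    have h2 := (norm_snd_le w).trans (hR w hw)
    constructor <;> linarith
  obtain ⟨C₀, hC₀t, hgrid⟩ := exists_gridMax_bound μ hd hr hp hq hpr hqr
    (hcont p q r hpqr) hμ hγ
  have hC₀ : 3 ^ d * C₀ ≠ ∞ := ENNReal.mul_ne_top (by simp) hC₀t
  refine ⟨(3 ^ d * C₀).toNNReal, fun f g h hf hg hh => ?_⟩
  rw [ENNReal.coe_toNNReal hC₀]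
  obtain ⟨f₁, hf₁, hff⟩ := hf.aestronglyMeasurable.aemeasurable
  obtain ⟨g₁, hg₁, hgg⟩ := hg.aestronglyMeasurable.aemeasurable
  obtain ⟨h₁, hh₁, hhh⟩ := hh.aestronglyMeasurable.aemeasurable
  set Φ : ℕ → Euc d → ℝ≥0∞ := truncMax μ f₁ g₁
  have hΦm : ∀ N, Measurable (Φ N) := measurable_truncMax μ hf₁ hg₁
  have hΦmono : Monotone fun N x => Φ N x * ‖h₁ x‖ₑ := fun N M hNM x =>
    mul_le_mul' (monotone_truncMax μ hf₁ hg₁ x hNM) le_rfl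
  have hlac : ∀ᵐ x, lacunaryMax μ f g x ≤ ⨆ N, Φ N x := ae_lacunaryMax_le μ hf₁ hg₁ hff hgg
  calc ∫⁻ x, lacunaryMax μ f g x * ‖h x‖ₑ ≤ ∫⁻ x, ⨆ N, Φ N x * ‖h₁ x‖ₑ := by
        refine lintegral_mono_ae ?_
        filter_upwards [hlac, hhh] with x h1 h2
        rw [← ENNReal.iSup_mul, h2]
        exact mul_le_mul' h1 le_rfl
    _ = ⨆ N, ∫⁻ x, Φ N x * ‖h₁ x‖ₑ :=
        lintegral_iSup (fun N => (hΦm N).mul hh₁.enorm) hΦmono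
    _ ≤ _ := by
        refine iSup_le fun N => ?_
        have hfN := measurable_truncAbs hf₁ N
        have hgN := measurable_truncAbs hg₁ N
        refine (lintegral_iSup_bilinConv_le μ (p := p) (q := q) (r := r) (n₀ := n₀) (C := C₀)
          (γ := γ) hfN hgN hh₁ (fun s b K hbK => ?_) N).trans ?_
        · exact hgrid s _ _ h₁ N hfN hgN hh₁ (norm_truncAbs_le f₁ N) (norm_truncAbs_le g₁ N) b K hbK
        · gcongr with S
          have hle : ∀ {f f₁ : Euc d → ℂ}, f =ᵐ[volume] f₁ →
              ∀ᵐ x, ‖truncAbs f₁ N x‖ₑ ≤ ‖f x‖ₑ := by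
            intro f f₁ hff
            filter_upwards [hff] with x hx
            rw [enorm_truncAbs, hx]
            exact min_le_left _ _
          refine ENNReal.tsum_le_tsum fun Q => ?_
          gcongr
          · exact cubeAvg_mono (hle hff) Q (by linarith)
          · exact cubeAvg_mono (hle hgg) Q (by linarith)
          · exact cubeAvg_mono (hhh.mono fun x hx => by rw [hx]) Q (by positivity)
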